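/- Let $M$ and $N$ be closed connected smooth surfaces, that is, compact connected Hausdorff $C^\infty$ $2$-manifolds without boundary, possibly nonorientable. The geometric degree $\mathrm{Deg}\,f$ of a continuous map $f:M\to N$ is the minimal cardinality of $h^{-1}(y)$, taken over all $C^\infty$ maps $h:M\to N$ homotopic to $f$ and all regular values $y\in N$ of $h$ (points outside the image of $h$ count as regular values). A $C^\infty$ map $f:M\to N$ is called a $k$-sheeted branched covering if there is a discrete subset $B\subset N$, with discrete preimage $f^{-1}(B)\subset M$, such that every point of $N\setminus B$ has an open neighbourhood in $N$ that is evenly covered by $f$ (so that $f$ is a covering over $N\setminus B$), and every point of $N\setminus B$ has exactly $k$ preimages. Then every $k$-sheeted branched covering $f:M\to N$ satisfies $\mathrm{Deg}\,f=k$. -/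

import Mathlib

open scoped Manifold ContDiff

/-- `y` is a regular value of a map `h` between surfaces: the differential of `h` is onto at every
point of the fibre over `y` (in particular every point outside the image is a regular value). -/
def IsRegularValue {M N : Type*}
    [TopologicalSpace M] [ChartedSpace (EuclideanSpace ℝ (Fin 2)) M]
    [TopologicalSpace N] [ChartedSpace (EuclideanSpace ℝ (Fin 2)) N]
    (h : M → N) (y : N) : Prop :=
  ∀ x : M, h x = y → Function.Surjective (mfderiv (𝓡 2) (𝓡 2) h x)

/-- The geometric degree of `f`: the minimal cardinality of the fibre over a regular value,
among all smooth maps homotopic to `f`. The infimum is taken in `ℕ∞`, so that it is attained as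
soon as there is such a map with such a value, and it is `⊤` (not `0`) otherwise. -/
noncomputable def geometricDegree {M N : Type*}
    [TopologicalSpace M] [ChartedSpace (EuclideanSpace ℝ (Fin 2)) M]
    [TopologicalSpace N] [ChartedSpace (EuclideanSpace ℝ (Fin 2)) N]
    (f : C(M, N)) : ℕ∞ :=
  sInf {d : ℕ∞ | ∃ (h : C(M, N)) (y : N), ContMDiff (𝓡 2) (𝓡 2) ∞ h ∧ h.Homotopic f ∧
    IsRegularValue h y ∧ (h ⁻¹' {y}).encard = d}

/-- `f` is a `k`-sheeted branched covering: for some discrete `B` whose preimage is discrete too,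
`f` is a covering map over the complement of `B`, with exactly `k` points in each fibre there. -/
def IsBranchedCovering {M N : Type*} [TopologicalSpace M] [TopologicalSpace N]
    (k : ℕ) (f : M → N) : Prop :=
  ∃ B : Set N, IsDiscrete B ∧ IsDiscrete (f ⁻¹' B) ∧ IsCoveringMapOn f Bᶜ ∧
    ∀ y ∈ Bᶜ, (f ⁻¹' {y}).encard = k

open Set Filter Topology MeasureTheory

/-! The upper bound is attained by `f` itself: by Sard and Baire it has a regular value off the
branch set `B`, and the fibre there has `k` points.

The lower bound needs a homotopy invariant that is dominated by the size of every regular fibre.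
Without orientations the usual degree is replaced by a twisted one. An `IsOrientationLift`
identifies the orientation character of `M` with the pullback of that of `N`; each regular point
then has a sign, and `HasTwistedDegree` records the signed count of a generic fibre. A branched
covering has a lift for which all signs are `+1`: the Jacobian of a local homeomorphism never
changes sign (`Plane.eventually_sign_det_eq`), and a punctured disc is connected, so the sign
extends over branch points (`exists_isOrientationLift`). Hence its twisted degree is `k`.

For invariance, consider first a change of the map inside one chart. A signed count is the integral
of the pullback of a concentrated density `∂ᵤP du ∧ dv = d(P dv)`, and a change on a compact set
alters that integral by the integral of a compactly supported exact form, which is zero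
(`Plane.finsum_localIndex_eq`). Two nearby smooth maps differ by finitely many such changes
(`eventually_hasTwistedDegree_imp`), and smooth maps are dense, so a connectedness argument along
the homotopy finishes (`HasTwistedDegree.of_homotopic`).

Finally, a generic fibre has at least `k` points because each sign has absolute value at most one,
and fibres near a regular fibre are no larger than it (`HasTwistedDegree.le_encard`). -/

/-- The Euclidean plane. -/
abbrev Plane : Type := EuclideanSpace ℝ (Fin 2)

/-! ### Stokes' theorem for pulled-back densities in the plane. -/

namespace Plane

/-- The two standard basis vectors. -/
noncomputable abbrev basisVec (i : Fin 2) : Plane := EuclideanSpace.single i (1 : ℝ)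

/-- The coordinate functionals. -/
noncomputable abbrev coord (i : Fin 2) : Plane →L[ℝ] ℝ := EuclideanSpace.proj i

theorem det_eq (A : Plane →L[ℝ] Plane) :
    A.det = A (basisVec 0) 0 * A (basisVec 1) 1 - A (basisVec 1) 0 * A (basisVec 0) 1 := by
  have h := LinearMap.det_toMatrix (EuclideanSpace.basisFun (Fin 2) ℝ).toBasis
    (A : Plane →ₗ[ℝ] Plane)
  rw [ContinuousLinearMap.det, ← h, Matrix.det_fin_two]
  simp [LinearMap.toMatrix_apply]

theorem eq_sum_basisVec (w : Plane) : w = w 0 • basisVec 0 + w 1 • basisVec 1 := by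
  ext i
  fin_cases i <;> simp

theorem integral_fderiv_eq_zero {A : Plane → ℝ} (hA : ContDiff ℝ 1 A) (hc : HasCompactSupport A)
    (v : Plane) : ∫ x, fderiv ℝ A x v = 0 := by
  have h := integral_mul_fderiv_eq_neg_fderiv_mul_of_integrable (μ := (volume : Measure Plane))
    (f := fun _ => (1 : ℝ)) (g := A) (v := v) (by simp) ?_ ?_ ?_ ?_
  · simpa using h
  · have : Continuous fun x => fderiv ℝ A x v :=
      (hA.continuous_fderiv one_ne_zero).clm_apply continuous_const
    simpa using this.integrable_of_hasCompactSupport (hc.fderiv_apply ℝ v)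
  · simpa using hA.continuous.integrable_of_hasCompactSupport hc
  · intro x _; fun_prop
  · intro x _; exact (hA.differentiable one_ne_zero) x

/-- The component `P(F) ∂ᵢF₁` of the pullback under `F` of the one-form `P dv`. -/
noncomputable def pullbackForm (P : Plane → ℝ) (F : Plane → Plane) (i : Fin 2) (x : Plane) : ℝ :=
  P (F x) * (fderiv ℝ F x (basisVec i)) 1

section

variable {P : Plane → ℝ} {F F' : Plane → Plane} {W K : Set Plane} {x : Plane}

theorem contDiffAt_pullbackForm (hP : ContDiff ℝ 1 P) (hF : ContDiffAt ℝ 2 F x) (i : Fin 2) :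
    ContDiffAt ℝ 1 (pullbackForm P F i) x := by
  have h1 : ContDiffAt ℝ 1 (fderiv ℝ F) x := hF.fderiv_right (by norm_num [one_add_one_eq_two])
  have h2 : ContDiffAt ℝ 1 (fun x => coord 1 (fderiv ℝ F x (basisVec i))) x :=
    (coord 1).contDiff.contDiffAt.comp x (h1.clm_apply contDiffAt_const)
  exact (hP.contDiffAt.comp x (hF.of_le one_le_two)).mul h2

theorem fderiv_pullbackForm (hP : ContDiff ℝ 1 P) (hF : ContDiffAt ℝ 2 F x) (i : Fin 2)
    (v : Plane) :
    fderiv ℝ (pullbackForm P F i) x v =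
      fderiv ℝ P (F x) (fderiv ℝ F x v) * (fderiv ℝ F x (basisVec i)) 1 +
      P (F x) * (fderiv ℝ (fderiv ℝ F) x v (basisVec i)) 1 := by
  have h1 : ContDiffAt ℝ 1 (fderiv ℝ F) x := hF.fderiv_right (by norm_num [one_add_one_eq_two])
  have h2 : HasFDerivAt (fderiv ℝ F) (fderiv ℝ (fderiv ℝ F) x) x :=
    (h1.differentiableAt one_ne_zero).hasFDerivAt
  have h3 : HasFDerivAt F (fderiv ℝ F x) x := (hF.differentiableAt two_ne_zero).hasFDerivAt
  have h4 : HasFDerivAt P (fderiv ℝ P (F x)) (F x) :=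
    (hP.differentiable one_ne_zero (F x)).hasFDerivAt
  have h5 := (coord 1).hasFDerivAt.comp x
    (h2.clm_apply (hasFDerivAt_const (basisVec i) x))
  have h6 := (h4.comp x h3).mul h5
  have h7 : fderiv ℝ (pullbackForm P F i) x = _ := h6.fderiv
  rw [h7]
  simp
  ring

/-- The exterior derivative of the pullback of `P dv` is the pullback of `∂ᵤP du ∧ dv`. -/
theorem fderiv_pullbackForm_sub (hP : ContDiff ℝ 1 P) (hF : ContDiffAt ℝ 2 F x) :
    fderiv ℝ (pullbackForm P F 1) x (basisVec 0) - fderiv ℝ (pullbackForm P F 0) x (basisVec 1) =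
      fderiv ℝ P (F x) (basisVec 0) * (fderiv ℝ F x).det := by
  -- The second-order terms cancel by symmetry of the second derivative; what is left of first order
  -- is a determinant.
  rw [fderiv_pullbackForm hP hF, fderiv_pullbackForm hP hF,
    (hF.isSymmSndFDerivAt (by simp)).eq (basisVec 0) (basisVec 1), det_eq]
  have h (w : Plane) : fderiv ℝ P (F x) w =
      w 0 * fderiv ℝ P (F x) (basisVec 0) + w 1 * fderiv ℝ P (F x) (basisVec 1) := by
    conv_lhs => rw [eq_sum_basisVec w]
    simp only [map_add, map_smul, smul_eq_mul]
  rw [h (fderiv ℝ F x (basisVec 0)), h (fderiv ℝ F x (basisVec 1))]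
  ring

/-- The integrand is the exterior derivative of the difference of the two pullbacks of `P dv`. That
difference vanishes off `K`, so its extension by zero is a compactly supported `C¹` form on the
whole plane, and partial derivatives of its coefficients integrate to zero. -/
theorem integral_density_sub_eq_zero (hP : ContDiff ℝ 1 P) (hW : IsOpen W) (hK : IsCompact K)
    (hKW : K ⊆ W) (hF : ∀ x ∈ W, ContDiffAt ℝ 2 F x) (hF' : ∀ x ∈ W, ContDiffAt ℝ 2 F' x)
    (heq : EqOn F F' (W \ K)) :
    ∫ x in W, (fderiv ℝ P (F x) (basisVec 0) * (fderiv ℝ F x).det -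
      fderiv ℝ P (F' x) (basisVec 0) * (fderiv ℝ F' x).det) = 0 := by
  let A : Fin 2 → Plane → ℝ := fun i => W.indicator
    fun x => pullbackForm P F i x - pullbackForm P F' i x
  have hopen : IsOpen (W \ K) := hW.sdiff hK.isClosed
  have hout (i : Fin 2) : ∀ x ∉ K, A i x = 0 := by
    intro x hx
    by_cases hxW : x ∈ W
    · have h1 : F =ᶠ[𝓝 x] F' := by
        filter_upwards [hopen.mem_nhds ⟨hxW, hx⟩] with y hy using heq hy
      simp [A, hxW, pullbackForm, h1.fderiv_eq, h1.eq_of_nhds]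
    · simp [A, hxW]
  have hsupp (i : Fin 2) : HasCompactSupport (A i) := HasCompactSupport.intro hK (hout i)
  have hin (i : Fin 2) {x : Plane} (hx : x ∈ W) :
      A i =ᶠ[𝓝 x] fun x => pullbackForm P F i x - pullbackForm P F' i x := by
    filter_upwards [hW.mem_nhds hx] with y hy using indicator_of_mem hy _
  have hsm (i : Fin 2) : ContDiff ℝ 1 (A i) := by
    rw [contDiff_iff_contDiffAt]
    intro x
    by_cases hx : x ∈ W
    · exact ((contDiffAt_pullbackForm hP (hF x hx) i).sub
        (contDiffAt_pullbackForm hP (hF' x hx) i)).congr_of_eventuallyEq (hin i hx)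
    · have : A i =ᶠ[𝓝 x] fun _ => 0 := by
        filter_upwards [hK.isClosed.isOpen_compl.mem_nhds fun h => hx (hKW h)] with y hy
          using hout i y hy
      exact contDiffAt_const.congr_of_eventuallyEq this
  have hint (i : Fin 2) (v : Plane) : Integrable fun x => fderiv ℝ (A i) x v :=
    (((hsm i).continuous_fderiv one_ne_zero).clm_apply
      continuous_const).integrable_of_hasCompactSupport ((hsupp i).fderiv_apply ℝ v)
  have key : ∫ x, (fderiv ℝ (A 1) x (basisVec 0) - fderiv ℝ (A 0) x (basisVec 1)) = 0 := by
    rw [integral_sub (hint _ _) (hint _ _), integral_fderiv_eq_zero (hsm _) (hsupp _),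
      integral_fderiv_eq_zero (hsm _) (hsupp _), sub_zero]
  have hval : ∀ x ∈ W, fderiv ℝ (A 1) x (basisVec 0) - fderiv ℝ (A 0) x (basisVec 1) =
      fderiv ℝ P (F x) (basisVec 0) * (fderiv ℝ F x).det -
      fderiv ℝ P (F' x) (basisVec 0) * (fderiv ℝ F' x).det := by
    intro x hx
    have hd (i : Fin 2) : fderiv ℝ (A i) x =
        fderiv ℝ (pullbackForm P F i) x - fderiv ℝ (pullbackForm P F' i) x := by
      rw [(hin i hx).fderiv_eq]
      exact fderiv_sub ((contDiffAt_pullbackForm hP (hF x hx) i).differentiableAt one_ne_zero)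
        ((contDiffAt_pullbackForm hP (hF' x hx) i).differentiableAt one_ne_zero)
    rw [hd, hd, ← fderiv_pullbackForm_sub hP (hF x hx), ← fderiv_pullbackForm_sub hP (hF' x hx)]
    simp only [_root_.sub_apply]
    ring
  rw [← setIntegral_congr_fun hW.measurableSet hval, setIntegral_eq_integral_of_forall_compl_eq_zero,
    key]
  intro x hx
  have (i : Fin 2) : A i =ᶠ[𝓝 x] fun _ => 0 := by
    filter_upwards [hK.isClosed.isOpen_compl.mem_nhds fun h => hx (hKW h)] with y hy
      using hout i y hy
  simp [(this _).fderiv_eq]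

end

/-- There are arbitrarily concentrated nonnegative densities of the form `∂ᵤP`. -/
theorem exists_density (z : Plane) {ε : ℝ} (hε : 0 < ε) :
    ∃ P : Plane → ℝ, ContDiff ℝ 1 P ∧
      (∀ w, fderiv ℝ P w (basisVec 0) ≠ 0 → w ∈ Metric.ball z ε) ∧
      0 < ∫ w, fderiv ℝ P w (basisVec 0) := by
  -- Half-width `ε / 2` in each coordinate keeps the square inside the disc of radius `ε`.
  let b (i : Fin 2) : ContDiffBump (z i) := ⟨ε / 4, ε / 2, by positivity, by linarith⟩
  have hb (i : Fin 2) : ContDiff ℝ 1 (b i) := (b i).contDiff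
  let a : ℝ → ℝ := fun t => ∫ s in (0 : ℝ)..t, b 0 s
  have ha (t : ℝ) : HasDerivAt a (b 0 t) t :=
    intervalIntegral.integral_hasDerivAt_right ((b 0).continuous.intervalIntegrable _ _)
      ((b 0).continuous.stronglyMeasurableAtFilter _ _) (b 0).continuous.continuousAt
  have hac : ContDiff ℝ 1 a := by
    rw [contDiff_one_iff_deriv]
    refine ⟨fun t => (ha t).differentiableAt, ?_⟩
    rw [show deriv a = b 0 from funext fun t => (ha t).deriv]
    exact (b 0).continuous
  -- `P` need not have compact support; only its derivative `b 0 (w 0) * b 1 (w 1)` is concentrated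
  -- near `z`.
  let P : Plane → ℝ := fun w => a (w 0) * b 1 (w 1)
  have hP : ContDiff ℝ 1 P :=
    (hac.comp (coord 0).contDiff).mul ((hb 1).comp (coord 1).contDiff)
  have hder (w : Plane) : fderiv ℝ P w (basisVec 0) = b 0 (w 0) * b 1 (w 1) := by
    have h0 : HasFDerivAt (fun w : Plane => a (w 0)) _ w :=
      HasFDerivAt.comp (f := coord 0) (g := a) w (ha (w 0)).hasFDerivAt (coord 0).hasFDerivAt
    have h1 : HasFDerivAt (fun w : Plane => b 1 (w 1)) _ w :=
      HasFDerivAt.comp (f := coord 1) (g := b 1) w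
        ((hb 1).differentiable one_ne_zero (w 1)).hasDerivAt.hasFDerivAt (coord 1).hasFDerivAt
    rw [show fderiv ℝ P w = _ from (h0.mul h1).fderiv]
    simp
    ring
  have hball (w : Plane) (hw : fderiv ℝ P w (basisVec 0) ≠ 0) : w ∈ Metric.ball z ε := by
    rw [hder, mul_ne_zero_iff] at hw
    have h (i : Fin 2) (hi : b i (w i) ≠ 0) : |w i - z i| < ε / 2 := by
      have : w i ∈ Function.support (b i) := hi
      rw [(b i).support_eq] at this
      simpa [Real.dist_eq] using this
    have h0 := h 0 hw.1
    have h1 := h 1 hw.2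
    rw [Metric.mem_ball, EuclideanSpace.dist_eq, Real.sqrt_lt' hε]
    simp only [Fin.sum_univ_two, Real.dist_eq]
    have := abs_nonneg (w 0 - z 0)
    have := abs_nonneg (w 1 - z 1)
    nlinarith
  have hcont : Continuous fun w => fderiv ℝ P w (basisVec 0) :=
    (hP.continuous_fderiv one_ne_zero).clm_apply continuous_const
  refine ⟨P, hP, hball, ?_⟩
  refine hcont.integral_pos_of_hasCompactSupport_nonneg_nonzero ?_ ?_ (x := z) ?_
  · refine HasCompactSupport.intro (isCompact_closedBall z ε) fun x hx => ?_
    by_contra h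
    exact hx (Metric.ball_subset_closedBall (hball x h))
  · intro w
    simp only [hder]
    exact mul_nonneg (b 0).nonneg (b 1).nonneg
  · rw [hder, (b 0).one_of_mem_closedBall, (b 1).one_of_mem_closedBall] <;>
    simp [(b _).rIn_pos.le]

end Plane

theorem ContinuousAt.eventually_sign_eq {X : Type*} [TopologicalSpace X] {g : X → ℝ} {x : X}
    (hg : ContinuousAt g x) (h0 : g x ≠ 0) :
    ∀ᶠ y in 𝓝 x, SignType.sign (g y) = SignType.sign (g x) := by
  rcases h0.lt_or_gt with h | h
  · filter_upwards [hg.eventually_lt_const h] with y hy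
    rw [sign_neg hy, sign_neg h]
  · filter_upwards [hg.eventually_const_lt h] with y hy
    rw [sign_pos hy, sign_pos h]

/-! ### Signed fibre counts of plane maps. -/

namespace Plane

/-- The sign with which a point of the fibre over `z` counts, and zero off the fibre. -/
noncomputable def localIndex (F : Plane → Plane) (z x : Plane) : ℝ :=
  open Classical in if F x = z then ((SignType.sign (fderiv ℝ F x).det : SignType) : ℝ) else 0

variable {F F' : Plane → Plane} {W K : Set Plane} {x z : Plane}

theorem localIndex_of_ne (h : F x ≠ z) : localIndex F z x = 0 := if_neg h

theorem continuousAt_det_fderiv (hF : ContDiffAt ℝ 2 F x) :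
    ContinuousAt (fun y => (fderiv ℝ F y).det) x :=
  ContinuousLinearMap.continuous_det.continuousAt.comp
    (hF.fderiv_right (m := 1) (by norm_num [one_add_one_eq_two])).continuousAt

/-- The inverse function theorem, with the sign of the Jacobian determinant kept. -/
theorem exists_openPartialHomeomorph_of_det_ne_zero (hW : IsOpen W)
    (hF : ∀ x ∈ W, ContDiffAt ℝ 2 F x) (hx : x ∈ W) (hdet : (fderiv ℝ F x).det ≠ 0) :
    ∃ e : OpenPartialHomeomorph Plane Plane, x ∈ e.source ∧ e.source ⊆ W ∧ (e : Plane → Plane) = F ∧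
      ∀ y ∈ e.source, SignType.sign (fderiv ℝ F y).det = SignType.sign (fderiv ℝ F x).det := by
  have hs : HasStrictFDerivAt F
      ((ContinuousLinearEquiv.ofBijective (fderiv ℝ F x)
        (LinearMap.ker_eq_bot.2 (LinearMap.equivOfDetNeZero _ hdet).injective)
        (LinearMap.range_eq_top.2 (LinearMap.equivOfDetNeZero _ hdet).surjective)) :
        Plane →L[ℝ] Plane) x := by
    rw [ContinuousLinearEquiv.coe_ofBijective]
    exact (hF x hx).hasStrictFDerivAt two_ne_zero
  have hev : ∀ᶠ y in 𝓝 x,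
      SignType.sign (fderiv ℝ F y).det = SignType.sign (fderiv ℝ F x).det :=
    (continuousAt_det_fderiv (hF x hx)).eventually_sign_eq hdet
  obtain ⟨S, hS, hSo, hxS⟩ := eventually_nhds_iff.1 hev
  refine ⟨(hs.toOpenPartialHomeomorph F).restrOpen (S ∩ W) (hSo.inter hW),
    ⟨hs.mem_toOpenPartialHomeomorph_source, hxS, hx⟩, fun y hy => hy.2.2, rfl,
    fun y hy => hS y hy.2.1⟩

/-- On the fibre, `F` is locally a diffeomorphism of constant sign and the change of variables
formula applies; off the fibre, `F` locally avoids a disc around `z`. Allowing every smaller `U`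
lets the neighbourhoods be made disjoint later. -/
theorem eventually_integral_eq_localIndex (hW : IsOpen W) (hF : ∀ x ∈ W, ContDiffAt ℝ 2 F x)
    (hx : x ∈ W) (hreg : F x = z → (fderiv ℝ F x).det ≠ 0) :
    ∃ O, IsOpen O ∧ x ∈ O ∧ O ⊆ W ∧ (∀ y ∈ O, F y = z → y = x) ∧
      ∀ U, IsOpen U → x ∈ U → U ⊆ O → ∀ᶠ ε in 𝓝[>] (0 : ℝ), ∀ ρ : Plane → ℝ,
      (∀ w, ρ w ≠ 0 → w ∈ Metric.ball z ε) →
      ∫ y in U, ρ (F y) * (fderiv ℝ F y).det = localIndex F z x * ∫ w, ρ w := by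
  have hcF : ContinuousOn F W := fun y hy => (hF y hy).continuousAt.continuousWithinAt
  by_cases hz : F x = z
  · obtain ⟨e, hxe, heW, hcoe, hsign⟩ :=
      exists_openPartialHomeomorph_of_det_ne_zero hW hF hx (hreg hz)
    refine ⟨e.source, e.open_source, hxe, heW, fun y hy hyz => ?_, fun U hU hxU hUe => ?_⟩
    · exact e.injOn hy hxe (by rw [hcoe, hyz, hz])
    have himage : IsOpen (F '' U) := hcoe ▸ e.isOpen_image_of_subset_source hU hUe
    obtain ⟨ε₀, hε₀, hball⟩ := Metric.isOpen_iff.1 himage z ⟨x, hxU, hz⟩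
    filter_upwards [Ioo_mem_nhdsGT hε₀] with ε hε ρ hρ
    have hinj : InjOn F U := hcoe ▸ e.injOn.mono hUe
    have hcv := integral_image_eq_integral_abs_det_fderiv_smul volume hU.measurableSet
      (fun y hy => ((hF y (heW (hUe hy))).differentiableAt
        two_ne_zero).hasFDerivAt.hasFDerivWithinAt) hinj ρ
    have hout : ∫ w in F '' U, ρ w = ∫ w, ρ w := by
      apply setIntegral_eq_integral_of_forall_compl_eq_zero
      intro w hw
      by_contra h
      exact hw (hball (Metric.ball_subset_ball hε.2.le (hρ w h)))
    rw [← hout, hcv, ← integral_const_mul, localIndex, if_pos hz]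
    refine setIntegral_congr_fun hU.measurableSet fun y hy => ?_
    simp only [smul_eq_mul, ← hsign y (hUe hy), ← mul_assoc, sign_mul_abs]
    ring
  · have hd : 0 < dist (F x) z := dist_pos.2 hz
    let O := W ∩ F ⁻¹' (Metric.closedBall z (dist (F x) z / 2))ᶜ
    refine ⟨O, hcF.isOpen_inter_preimage hW Metric.isClosed_closedBall.isOpen_compl,
      ⟨hx, by simp [hd]⟩, inter_subset_left, fun y hy hyz => ?_, fun U hU hxU hUO => ?_⟩
    · exact (hy.2 (by rw [hyz]; exact Metric.mem_closedBall_self (half_pos hd).le)).elim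
    filter_upwards [Ioo_mem_nhdsGT (half_pos hd)] with ε hε ρ hρ
    rw [localIndex, if_neg hz, zero_mul]
    refine setIntegral_eq_zero_of_forall_eq_zero fun y hy => ?_
    by_contra h
    refine (hUO hy).2 (Metric.ball_subset_closedBall ?_)
    exact Metric.ball_subset_ball hε.2.le (hρ _ (left_ne_zero_of_mul h))

theorem finite_inter_fiber (hW : IsOpen W) (hK : IsCompact K) (hKW : K ⊆ W)
    (hF : ∀ x ∈ W, ContDiffAt ℝ 2 F x) (hreg : ∀ x ∈ K, F x = z → (fderiv ℝ F x).det ≠ 0) :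
    (K ∩ F ⁻¹' {z}).Finite := by
  choose! O hO hxO _ huniq _ using fun x (hx : x ∈ K) =>
    eventually_integral_eq_localIndex (z := z) hW hF (hKW hx) (hreg x hx)
  obtain ⟨t, ht, hcov⟩ := hK.elim_nhds_subcover O fun x hx => (hO x hx).mem_nhds (hxO x hx)
  refine t.finite_toSet.subset fun y hy => ?_
  obtain ⟨x, hxt, hyx⟩ := mem_iUnion₂.1 (hcov hy.1)
  rw [huniq x (ht x hxt) y hyx hy.2]
  exact hxt

theorem eventually_notMem_ball (hK : IsCompact K) (hF : ContinuousOn F K)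
    (hz : ∀ x ∈ K, F x ≠ z) : ∀ᶠ ε in 𝓝[>] (0 : ℝ), ∀ x ∈ K, F x ∉ Metric.ball z ε := by
  have h : (F '' K)ᶜ ∈ 𝓝 z := (hK.image_of_continuousOn hF).isClosed.isOpen_compl.mem_nhds
    fun ⟨x, hx, hxz⟩ => hz x hx hxz
  obtain ⟨ε₀, hε₀, hball⟩ := Metric.mem_nhds_iff.1 h
  filter_upwards [Ioo_mem_nhdsGT hε₀] with ε hε x hx hxε
  exact hball (Metric.ball_subset_ball hε.2.le hxε) ⟨x, hx, rfl⟩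

/-- The signed number of points of a fibre does not change when the map is changed in a compact
set. -/
theorem finsum_localIndex_eq (hW : IsOpen W) (hK : IsCompact K) (hKW : K ⊆ W)
    (hF : ∀ x ∈ W, ContDiffAt ℝ 2 F x) (hF' : ∀ x ∈ W, ContDiffAt ℝ 2 F' x)
    (heq : EqOn F F' (W \ K))
    (hreg : ∀ x ∈ K, F x = z → (fderiv ℝ F x).det ≠ 0)
    (hreg' : ∀ x ∈ K, F' x = z → (fderiv ℝ F' x).det ≠ 0) :
    ∑ᶠ x ∈ K, localIndex F z x = ∑ᶠ x ∈ K, localIndex F' z x := by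
  classical
  have hfin : ((K ∩ F ⁻¹' {z}) ∪ (K ∩ F' ⁻¹' {z})).Finite :=
    (finite_inter_fiber hW hK hKW hF hreg).union (finite_inter_fiber hW hK hKW hF' hreg')
  obtain ⟨T, hT⟩ := hfin.exists_finset_coe
  have hTK : ∀ x ∈ T, x ∈ K := fun x hx => by
    have : x ∈ (T : Set Plane) := hx
    rw [hT] at this
    exact this.elim And.left And.left
  have hTmem : ∀ x ∈ K, F x = z ∨ F' x = z → x ∈ T := fun x hx h => by
    have : x ∈ (T : Set Plane) := by
      rw [hT]
      exact h.imp (fun h => ⟨hx, h⟩) fun h => ⟨hx, h⟩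
    exact this
  choose! O hO hxO hOW huniq hint using fun x (hx : x ∈ K) =>
    eventually_integral_eq_localIndex (z := z) hW hF (hKW hx) (hreg x hx)
  choose! O' hO' hxO' hOW' huniq' hint' using fun x (hx : x ∈ K) =>
    eventually_integral_eq_localIndex (z := z) hW hF' (hKW hx) (hreg' x hx)
  obtain ⟨V, hV, hdisj⟩ := T.finite_toSet.t2_separation
  obtain ⟨L, hL, hKL, hLW⟩ := exists_compact_between hK hW hKW
  let U : Plane → Set Plane := fun x => O x ∩ O' x ∩ V x ∩ interior L
  have hUo : ∀ x ∈ T, IsOpen (U x) := fun x hx =>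
    (((hO x (hTK x hx)).inter (hO' x (hTK x hx))).inter (hV x).2).inter isOpen_interior
  have hxU : ∀ x ∈ T, x ∈ U x := fun x hx =>
    ⟨⟨⟨hxO x (hTK x hx), hxO' x (hTK x hx)⟩, (hV x).1⟩, hKL (hTK x hx)⟩
  have hUL : ∀ x, U x ⊆ L := fun x y hy => interior_subset hy.2
  let R : Set Plane := ⋃ x ∈ T, U x
  have hRo : IsOpen R := isOpen_biUnion hUo
  -- Off `G` the two maps agree. Inside `G`, both densities vanish on `G \ R ⊆ K \ R` for small `ε`,
  -- so each integral over `G` localizes to the disjoint sets `U x`. The compact set `L` containing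
  -- `G` supplies integrability.
  let G : Set Plane := K ∪ R
  have hGL : G ⊆ L := union_subset (hKL.trans interior_subset) (iUnion₂_subset fun x _ => hUL x)
  have hGm : MeasurableSet G := hK.measurableSet.union hRo.measurableSet
  have hKR : IsCompact (K \ R) := hK.diff hRo
  have hcont {F : Plane → Plane} (hF : ∀ x ∈ W, ContDiffAt ℝ 2 F x) : ContinuousOn F W :=
    fun y hy => (hF y hy).continuousAt.continuousWithinAt
  have hTR : ∀ x ∈ K \ R, x ∉ T := fun x hx hxT => hx.2 (mem_biUnion hxT (hxU x hxT))
  have hev : ∀ᶠ ε in 𝓝[>] (0 : ℝ), 0 < ε ∧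
      (∀ x ∈ T, ∀ ρ : Plane → ℝ, (∀ w, ρ w ≠ 0 → w ∈ Metric.ball z ε) →
        ∫ y in U x, ρ (F y) * (fderiv ℝ F y).det = localIndex F z x * ∫ w, ρ w) ∧
      (∀ x ∈ T, ∀ ρ : Plane → ℝ, (∀ w, ρ w ≠ 0 → w ∈ Metric.ball z ε) →
        ∫ y in U x, ρ (F' y) * (fderiv ℝ F' y).det = localIndex F' z x * ∫ w, ρ w) ∧
      (∀ x ∈ K \ R, F x ∉ Metric.ball z ε) ∧ ∀ x ∈ K \ R, F' x ∉ Metric.ball z ε := by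
    refine (eventually_mem_nhdsWithin).and (((Finset.eventually_all T).2 fun x hx => ?_).and
      (((Finset.eventually_all T).2 fun x hx => ?_).and
      ((eventually_notMem_ball hKR ((hcont hF).mono (sdiff_subset.trans hKW)) fun x hx h => ?_).and
      (eventually_notMem_ball hKR ((hcont hF').mono (sdiff_subset.trans hKW)) fun x hx h => ?_))))
    · exact hint x (hTK x hx) _ (hUo x hx) (hxU x hx) fun y hy => hy.1.1.1
    · exact hint' x (hTK x hx) _ (hUo x hx) (hxU x hx) fun y hy => hy.1.1.2
    · exact hTR x hx (hTmem x hx.1 (Or.inl h))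
    · exact hTR x hx (hTmem x hx.1 (Or.inr h))
  obtain ⟨ε, hε, hi, hi', ho, ho'⟩ := hev.exists
  obtain ⟨P, hP, hPε, hPpos⟩ := exists_density z hε
  let ρ : Plane → ℝ := fun w => fderiv ℝ P w (basisVec 0)
  have hρc : Continuous ρ := (hP.continuous_fderiv one_ne_zero).clm_apply continuous_const
  have hintg {F : Plane → Plane} (hF : ∀ x ∈ W, ContDiffAt ℝ 2 F x) :
      IntegrableOn (fun y => ρ (F y) * (fderiv ℝ F y).det) L := by
    refine ContinuousOn.integrableOn_compact hL ?_
    refine (hρc.comp_continuousOn ((hcont hF).mono hLW)).mul fun y hy => ?_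
    exact (continuousAt_det_fderiv (hF y (hLW hy))).continuousWithinAt
  have hcount {F : Plane → Plane} (hF : ∀ x ∈ W, ContDiffAt ℝ 2 F x)
      (hi : ∀ x ∈ T, ∫ y in U x, ρ (F y) * (fderiv ℝ F y).det = localIndex F z x * ∫ w, ρ w)
      (ho : ∀ x ∈ K \ R, F x ∉ Metric.ball z ε) (hTF : ∀ x ∈ K, F x = z → x ∈ T) :
      ∫ y in G, ρ (F y) * (fderiv ℝ F y).det = (∑ᶠ x ∈ K, localIndex F z x) * ∫ w, ρ w := by
    have h1 : ∑ᶠ x ∈ K, localIndex F z x = ∑ x ∈ T, localIndex F z x := by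
      refine finsum_mem_eq_sum_of_inter_support_eq _ (Set.ext fun x => ?_)
      refine ⟨fun hx => ⟨hTF x hx.1 ?_, hx.2⟩, fun hx => ⟨hTK x hx.1, hx.2⟩⟩
      by_contra h
      exact hx.2 (if_neg h)
    rw [h1, Finset.sum_mul, ← Finset.sum_congr rfl hi,
      ← integral_biUnion_finset T (fun x hx => (hUo x hx).measurableSet)
        (hdisj.mono fun x y hy => hy.1.2) fun x _ => (hintg hF).mono_set (hUL x)]
    refine setIntegral_eq_of_subset_of_forall_sdiff_eq_zero hGm subset_union_right fun y hy => ?_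
    by_contra h
    exact ho y ⟨hy.1.resolve_right hy.2, hy.2⟩ (hPε _ (left_ne_zero_of_mul h))
  have h1 := hcount hF (fun x hx => hi x hx ρ hPε) ho fun x hx h => hTmem x hx (Or.inl h)
  have h2 := hcount hF' (fun x hx => hi' x hx ρ hPε) ho' fun x hx h => hTmem x hx (Or.inr h)
  have h3 : ∫ y in G, (ρ (F y) * (fderiv ℝ F y).det - ρ (F' y) * (fderiv ℝ F' y).det) = 0 := by
    rw [← integral_density_sub_eq_zero hP hW hK hKW hF hF' heq]
    refine (setIntegral_eq_of_subset_of_forall_sdiff_eq_zero hW.measurableSet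
      (hGL.trans hLW) fun y hy => ?_).symm
    have hopen : IsOpen (W \ K) := hW.sdiff hK.isClosed
    have : F =ᶠ[𝓝 y] F' := by
      filter_upwards [hopen.mem_nhds ⟨hy.1, fun h => hy.2 (Or.inl h)⟩] with w hw using heq hw
    rw [this.fderiv_eq, this.eq_of_nhds, sub_self]
  rw [integral_sub ((hintg hF).mono_set hGL) ((hintg hF').mono_set hGL), h1, h2, ← sub_mul] at h3
  exact sub_eq_zero.1 ((mul_eq_zero.1 h3).resolve_right hPpos.ne')

theorem finsum_mem_eq_of_forall_ne {α : Type*} {s : Set α} {g : α → ℝ} {a : α} (ha : a ∈ s)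
    (h : ∀ x ∈ s, x ≠ a → g x = 0) : ∑ᶠ x ∈ s, g x = g a := by
  rw [finsum_eq_single _ a fun x hx => ?_]
  · simp [ha]
  · by_cases hxs : x ∈ s
    · simp [hxs, h x hxs hx]
    · simp [hxs]

/-- The Jacobian determinant of a differentiable local homeomorphism does not change sign. -/
theorem eventually_sign_det_eq (e : OpenPartialHomeomorph Plane Plane) {x₀ : Plane}
    (hx₀ : x₀ ∈ e.source) (heF : EqOn e F e.source) (hF : ∀ x ∈ e.source, ContDiffAt ℝ 2 F x) :
    ∃ U ∈ 𝓝 x₀, ∀ p ∈ U, ∀ q ∈ U, (fderiv ℝ F p).det ≠ 0 → (fderiv ℝ F q).det ≠ 0 →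
      SignType.sign (fderiv ℝ F p).det = SignType.sign (fderiv ℝ F q).det := by
  obtain ⟨r, hr, hrt⟩ := Metric.nhds_basis_closedBall.mem_iff.1
    (e.open_target.mem_nhds (e.map_source hx₀))
  let C : Set Plane := e.symm '' Metric.closedBall (e x₀) r
  have hC : IsCompact C := (isCompact_closedBall _ _).image_of_continuousOn
    (e.continuousOn_symm.mono hrt)
  have hCe : C ⊆ e.source := by
    rintro _ ⟨w, hw, rfl⟩
    exact e.map_target (hrt hw)
  have hCmem : ∀ x ∈ e.source, F x ∈ Metric.ball (e x₀) r → x ∈ C := fun x hx hxr =>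
    ⟨e x, by rw [heF hx]; exact Metric.ball_subset_closedBall hxr, e.left_inv hx⟩
  obtain ⟨L, hL, hCL, hLe⟩ := exists_compact_between hC e.open_source hCe
  obtain ⟨χ, hχs, hχ1, hχ0, hχ⟩ : ∃ χ : Plane → ℝ, ContDiff ℝ 2 χ ∧ (∀ᶠ x in 𝓝ˢ C, χ x = 1) ∧
      (∀ x ∉ L, χ x = 0) ∧ ∀ x, χ x ∈ Icc (0 : ℝ) 1 :=
    let ⟨χ, h⟩ := exists_contMDiffMap_one_nhds_of_subset_interior (n := 2)
      𝓘(ℝ, Plane) hC.isClosed hCL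
    ⟨χ, χ.contMDiff.contDiff, h⟩
  refine ⟨e.source ∩ e ⁻¹' Metric.ball (e x₀) r, ?_, fun p hp q hq hdp hdq => ?_⟩
  · exact (e.isOpen_inter_preimage Metric.isOpen_ball).mem_nhds
      ⟨hx₀, mem_preimage.2 (Metric.mem_ball_self hr)⟩
  have hpr : F p ∈ Metric.ball (e x₀) r := by rw [← heF hp.1]; exact hp.2
  have hqr : F q ∈ Metric.ball (e x₀) r := by rw [← heF hq.1]; exact hq.2
  have hinj : InjOn F e.source := e.injOn.congr heF
  -- `F` is translated near `C` so that `q` takes the value `F p`. Over `F p`, the only preimage in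
  -- `L` is `p` for `F` and `q` for `F'`, so equality of the signed counts compares the two signs.
  let F' : Plane → Plane := fun x => F x + χ x • (F p - F q)
  have hF' : ∀ x ∈ e.source, ContDiffAt ℝ 2 F' x := fun x hx =>
    (hF x hx).add (hχs.contDiffAt.smul contDiffAt_const)
  have hone : ∀ x ∈ C, F' =ᶠ[𝓝 x] fun y => F y + (F p - F q) := by
    intro x hx
    filter_upwards [eventually_nhdsSet_iff_forall.1 hχ1 x hx] with y hy
    simp [F', hy]
  have hqC := hCmem q hq.1 hqr
  have hpL : p ∈ L := interior_subset (hCL (hCmem p hp.1 hpr))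
  have hqL : q ∈ L := interior_subset (hCL hqC)
  have hFp : ∀ x ∈ L, F x = F p → x = p := fun x hx h => hinj (hLe hx) hp.1 h
  have hF'q : ∀ x ∈ L, F' x = F p → x = q := by
    intro x hx h
    have h1 : F x = (1 - χ x) • F p + χ x • F q := by
      have : F x = F p - χ x • (F p - F q) := eq_sub_of_add_eq h
      rw [this]
      module
    -- Convexity of the ball forces `x ∈ C`, where the cutoff is `1`; hence `F x = F q`.
    have h2 : F x ∈ Metric.ball (e x₀) r := by
      rw [h1]
      exact convex_ball _ _ hpr hqr (sub_nonneg.2 (hχ x).2) (hχ x).1 (by ring)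
    have h3 : χ x = 1 := (eventually_nhdsSet_iff_forall.1 hχ1 x (hCmem x (hLe hx) h2)).self_of_nhds
    rw [h3] at h1
    exact hinj (hLe hx) hq.1 (by simpa using h1)
  have hderq : fderiv ℝ F' q = fderiv ℝ F q := by
    rw [(hone q hqC).fderiv_eq, fderiv_add_const]
  have hF'eq : F' q = F p := by rw [(hone q hqC).eq_of_nhds]; abel
  have key := finsum_localIndex_eq (z := F p) e.open_source hL hLe hF hF'
    (fun x hx => by simp [F', hχ0 x hx.2])
    (fun x hx h => by rwa [hFp x hx h]) (fun x hx h => by rwa [hF'q x hx h, hderq])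
  rw [finsum_mem_eq_of_forall_ne hpL fun x hx hne => localIndex_of_ne fun h => hne (hFp x hx h),
    finsum_mem_eq_of_forall_ne hqL fun x hx hne => localIndex_of_ne fun h => hne (hF'q x hx h),
    localIndex, localIndex, if_pos rfl, if_pos hF'eq, hderq] at key
  revert key
  rcases hdp.lt_or_gt with h | h <;> rcases hdq.lt_or_gt with h' | h' <;>
    simp only [sign_neg, sign_pos, h, h'] <;> norm_num

end Plane

theorem two_le_infty : (2 : WithTop ℕ∞) ≤ ∞ := 
  WithTop.coe_le_coe.2 (le_top : (2 : ℕ∞) ≤ ⊤)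

/-! ### Jacobian signs on surfaces, Sard's theorem, regular fibres. -/

section Jacobian

variable {M N N' : Type*}
  [TopologicalSpace M] [ChartedSpace (EuclideanSpace ℝ (Fin 2)) M]
  [TopologicalSpace N] [ChartedSpace (EuclideanSpace ℝ (Fin 2)) N]
  [TopologicalSpace N'] [ChartedSpace (EuclideanSpace ℝ (Fin 2)) N']

/-- The Jacobian determinant of a map between surfaces, in the preferred charts. -/
noncomputable def jac (h : M → N) (x : M) : ℝ :=
  ContinuousLinearMap.det (mfderiv (𝓡 2) (𝓡 2) h x : Plane →L[ℝ] Plane)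

/-- The expression of a map between surfaces in two charts. -/
def chartRep (c : OpenPartialHomeomorph M Plane) (d : OpenPartialHomeomorph N Plane) (h : M → N) :
    Plane → Plane := fun w => d (h (c.symm w))

theorem jac_comp {g : N → N'} {f : M → N} {x : M} (hg : MDifferentiableAt (𝓡 2) (𝓡 2) g (f x))
    (hf : MDifferentiableAt (𝓡 2) (𝓡 2) f x) : jac (g ∘ f) x = jac g (f x) * jac f x := by
  have h := mfderiv_comp x hg hf
  simp only [jac]
  rw [h]
  exact LinearMap.det_comp _ _

theorem jac_congr {f g : M → N} {x : M} (h : f =ᶠ[𝓝 x] g) : jac f x = jac g x := by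
  have := h.mfderiv_eq (I := 𝓡 2) (I' := 𝓡 2)
  simp only [jac]
  congr 1

theorem jac_eq_det_fderiv (F : Plane → Plane) (x : Plane) : jac F x = (fderiv ℝ F x).det := by
  have := mfderiv_eq_fderiv (𝕜 := ℝ) (f := F) (x := x)
  simp only [jac]
  rw [this]
  rfl

theorem jac_ne_zero_iff {h : M → N} {x : M} :
    jac h x ≠ 0 ↔ Function.Surjective (mfderiv (𝓡 2) (𝓡 2) h x) := by
  have key (A : Plane →L[ℝ] Plane) : A.det ≠ 0 ↔ Function.Surjective A := by
    have h1 := LinearMap.isUnit_iff_isUnit_det (A : Plane →ₗ[ℝ] Plane)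
    rw [LinearMap.isUnit_iff_range_eq_top, isUnit_iff_ne_zero] at h1
    exact h1.symm.trans LinearMap.range_eq_top
  exact key _

theorem isRegularValue_iff {h : M → N} {y : N} :
    IsRegularValue h y ↔ ∀ x, h x = y → jac h x ≠ 0 := by
  simp only [IsRegularValue, jac_ne_zero_iff]

variable [IsManifold (𝓡 2) ∞ M] [IsManifold (𝓡 2) ∞ N]

theorem jac_chart_ne_zero {c : OpenPartialHomeomorph M Plane} (hc : c ∈ atlas Plane M) {x : M}
    (hx : x ∈ c.source) : jac c x ≠ 0 :=
  haveI : IsManifold (𝓡 2) 1 M := .of_le (n := ∞) (by simp)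
  jac_ne_zero_iff.2 ((mdifferentiable_of_mem_atlas hc).mfderiv_bijective hx).surjective

theorem mdifferentiableAt_chart {c : OpenPartialHomeomorph M Plane} (hc : c ∈ atlas Plane M) {x : M}
    (hx : x ∈ c.source) : MDifferentiableAt (𝓡 2) (𝓡 2) c x :=
  haveI : IsManifold (𝓡 2) 1 M := .of_le (n := ∞) (by simp)
  (mdifferentiable_of_mem_atlas hc).mdifferentiableAt hx

theorem contMDiffAt_chart {c : OpenPartialHomeomorph M Plane} (hc : c ∈ atlas Plane M) {x : M}
    (hx : x ∈ c.source) : ContMDiffAt (𝓡 2) (𝓡 2) ∞ c x :=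
  contMDiffAt_of_mem_maximalAtlas (IsManifold.subset_maximalAtlas hc) hx

theorem contMDiffAt_chart_symm {c : OpenPartialHomeomorph M Plane} (hc : c ∈ atlas Plane M)
    {w : Plane} (hw : w ∈ c.target) : ContMDiffAt (𝓡 2) (𝓡 2) ∞ c.symm w :=
  contMDiffAt_symm_of_mem_maximalAtlas (IsManifold.subset_maximalAtlas hc) hw

variable {c : OpenPartialHomeomorph M Plane} {d : OpenPartialHomeomorph N Plane} {h : M → N} {x : M}

theorem contDiffAt_chartRep (hc : c ∈ atlas Plane M) (hd : d ∈ atlas Plane N)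
    (hh : ContMDiffAt (𝓡 2) (𝓡 2) ∞ h x) (hx : x ∈ c.source) (hhx : h x ∈ d.source) :
    ContDiffAt ℝ ∞ (chartRep c d h) (c x) := by
  rw [← contMDiffAt_iff_contDiffAt]
  have h1 := contMDiffAt_chart_symm hc (c.map_source hx)
  have h2 : ContMDiffAt (𝓡 2) (𝓡 2) ∞ h (c.symm (c x)) := by rwa [c.left_inv hx]
  have h3 : ContMDiffAt (𝓡 2) (𝓡 2) ∞ d (h (c.symm (c x))) :=
    contMDiffAt_chart hd (by rwa [c.left_inv hx])
  exact h3.comp (c x) (h2.comp (c x) h1)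

theorem jac_chartRep_mul (hc : c ∈ atlas Plane M) (hd : d ∈ atlas Plane N)
    (hh : ContMDiffAt (𝓡 2) (𝓡 2) ∞ h x) (hx : x ∈ c.source) (hhx : h x ∈ d.source) :
    (fderiv ℝ (chartRep c d h) (c x)).det * jac c x = jac d (h x) * jac h x := by
  have h1 : MDifferentiableAt (𝓡 2) (𝓡 2) (chartRep c d h) (c x) :=
    ((contDiffAt_chartRep hc hd hh hx hhx).contMDiffAt).mdifferentiableAt (by simp)
  rw [← jac_eq_det_fderiv, ← jac_comp h1 (mdifferentiableAt_chart hc hx),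
    ← jac_comp (mdifferentiableAt_chart hd hhx) (hh.mdifferentiableAt (by simp))]
  apply jac_congr
  filter_upwards [c.open_source.mem_nhds hx] with y hy
  simp [chartRep, c.left_inv hy]

/-- The sign of `jac h` may jump with the preferred charts. Correcting by the signs of two fixed
charts turns it into the sign of a determinant that varies continuously. -/
theorem sign_jac_eq (hc : c ∈ atlas Plane M) (hd : d ∈ atlas Plane N)
    (hh : ContMDiffAt (𝓡 2) (𝓡 2) ∞ h x) (hx : x ∈ c.source) (hhx : h x ∈ d.source) :
    SignType.sign (jac c x) * SignType.sign (jac d (h x)) * SignType.sign (jac h x) =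
      SignType.sign (fderiv ℝ (chartRep c d h) (c x)).det := by
  have h1 := congrArg SignType.sign (jac_chartRep_mul hc hd hh hx hhx)
  rw [sign_mul, sign_mul] at h1
  have h2 := sign_ne_zero.2 (jac_chart_ne_zero hc hx)
  have key (u v : SignType) : u ≠ 0 → u * (v * u) = v := by decide +revert
  rw [mul_assoc, ← h1, key _ _ h2]

theorem jac_ne_zero_iff_chartRep (hc : c ∈ atlas Plane M) (hd : d ∈ atlas Plane N)
    (hh : ContMDiffAt (𝓡 2) (𝓡 2) ∞ h x) (hx : x ∈ c.source) (hhx : h x ∈ d.source) :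
    jac h x ≠ 0 ↔ (fderiv ℝ (chartRep c d h) (c x)).det ≠ 0 := by
  have h1 := jac_chartRep_mul hc hd hh hx hhx
  have h2 := jac_chart_ne_zero hc hx
  have h3 := jac_chart_ne_zero hd hhx
  constructor
  · intro h4 h5
    rw [h5, zero_mul] at h1
    exact mul_ne_zero h3 h4 h1.symm
  · intro h4 h5
    rw [h5, mul_zero] at h1
    exact mul_ne_zero h4 h2 h1

/-- The sign comparing the orientations given by two charts is locally constant. -/
theorem eventually_sign_jac_mul_eq {c c' : OpenPartialHomeomorph M Plane} (hc : c ∈ atlas Plane M)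
    (hc' : c' ∈ atlas Plane M) {x : M} (hx : x ∈ c.source) (hx' : x ∈ c'.source) :
    ∀ᶠ x' in 𝓝 x, SignType.sign (jac c x') * SignType.sign (jac c' x') =
      SignType.sign (jac c x) * SignType.sign (jac c' x) := by
  have hid : jac (id : M → M) x ≠ 0 := by
    rw [jac_ne_zero_iff, mfderiv_id]
    exact Function.surjective_id
  have key {y : M} (hy : y ∈ c.source) (hy' : y ∈ c'.source) :
      SignType.sign (jac c y) * SignType.sign (jac c' y) =
        SignType.sign (fderiv ℝ (chartRep c c' id) (c y)).det := by
    have := sign_jac_eq hc hc' (h := id) contMDiffAt_id hy hy'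
    rw [← this]
    have h1 : jac (id : M → M) y = 1 := by
      simp only [jac]
      rw [mfderiv_id]
      exact LinearMap.det_id
    simp [h1]
  have hcont : ContinuousAt (fun y => (fderiv ℝ (chartRep c c' id) (c y)).det) x :=
    ContinuousAt.comp (f := c) (g := fun w => (fderiv ℝ (chartRep c c' id) w).det)
      (Plane.continuousAt_det_fderiv
      ((contDiffAt_chartRep hc hc' (h := id) contMDiffAt_id hx hx').of_le two_le_infty))
      (c.continuousAt hx)
  have hne := (jac_ne_zero_iff_chartRep hc hc' (h := id) contMDiffAt_id hx hx').1 hid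
  filter_upwards [c.open_source.mem_nhds hx, c'.open_source.mem_nhds hx',
    hcont.eventually_sign_eq hne] with y hy hy' hs
  rw [key hy hy', key hx hx', hs]

theorem isOpen_setOf_jac_ne_zero (hh : ContMDiff (𝓡 2) (𝓡 2) ∞ h) : IsOpen {x | jac h x ≠ 0} := by
  rw [isOpen_iff_mem_nhds]
  intro x hx
  have hc := chart_mem_atlas Plane x
  have hd := chart_mem_atlas Plane (h x)
  have hxs := mem_chart_source Plane x
  have hhx := mem_chart_source Plane (h x)
  have hcont := Plane.continuousAt_det_fderiv
    ((contDiffAt_chartRep hc hd hh.contMDiffAt hxs hhx).of_le (m := 2) two_le_infty)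
  have h1 := ((chartAt Plane x).continuousAt hxs).eventually
    (hcont.eventually_ne ((jac_ne_zero_iff_chartRep hc hd hh.contMDiffAt hxs hhx).1 hx))
  filter_upwards [h1, (chartAt Plane x).open_source.mem_nhds hxs,
    hh.continuous.continuousAt.preimage_mem_nhds ((chartAt Plane (h x)).open_source.mem_nhds hhx)]
    with y hy hys hyd
  exact (jac_ne_zero_iff_chartRep hc hd hh.contMDiffAt hys hyd).2 hy

theorem exists_injOn_of_jac_ne_zero (hh : ContMDiff (𝓡 2) (𝓡 2) ∞ h) (hx : jac h x ≠ 0) :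
    ∃ U, IsOpen U ∧ x ∈ U ∧ InjOn h U := by
  have hc := chart_mem_atlas Plane x
  have hd := chart_mem_atlas Plane (h x)
  set c := chartAt Plane x
  set d := chartAt Plane (h x)
  have hxs : x ∈ c.source := mem_chart_source Plane x
  have hhx : h x ∈ d.source := mem_chart_source Plane (h x)
  have hdet := (jac_ne_zero_iff_chartRep hc hd hh.contMDiffAt hxs hhx).1 hx
  have hW : IsOpen (c.target ∩ c.symm ⁻¹' (h ⁻¹' d.source)) :=
    c.symm.isOpen_inter_preimage (d.open_source.preimage hh.continuous)
  obtain ⟨e, hxe, heW, hcoe, -⟩ := Plane.exists_openPartialHomeomorph_of_det_ne_zero hW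
    (F := chartRep c d h) (fun w hw => by
      have := contDiffAt_chartRep hc hd hh.contMDiffAt (c.map_target hw.1) hw.2
      rw [c.right_inv hw.1] at this
      exact this.of_le two_le_infty)
    ⟨c.map_source hxs, by simpa [c.left_inv hxs] using hhx⟩ hdet
  refine ⟨c.source ∩ c ⁻¹' e.source, c.isOpen_inter_preimage e.open_source, ⟨hxs, hxe⟩, ?_⟩
  intro p hp q hq hpq
  refine c.injOn hp.1 hq.1 (e.injOn hp.2 hq.2 ?_)
  simp [hcoe, chartRep, c.left_inv hp.1, c.left_inv hq.1, hpq]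

/-- Sard's theorem for maps between closed surfaces. -/
theorem eventually_residual_isRegularValue [CompactSpace M] [T2Space M] [T2Space N]
    (hh : ContMDiff (𝓡 2) (𝓡 2) ∞ h) : ∀ᶠ y in residual N, IsRegularValue h y := by
  have : LocallyCompactSpace M := ChartedSpace.locallyCompactSpace Plane M
  let C : Set M := {x | jac h x ≠ 0}ᶜ
  have hC : IsClosed C := (isOpen_setOf_jac_ne_zero hh).isClosed_compl
  have hloc (x : M) : ∃ K ∈ 𝓝 x, (h '' (C ∩ K))ᶜ ∈ residual N := by
    have hc := chart_mem_atlas Plane x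
    have hd := chart_mem_atlas Plane (h x)
    set c := chartAt Plane x
    set d := chartAt Plane (h x)
    have hxs : x ∈ c.source := mem_chart_source Plane x
    have hhx : h x ∈ d.source := mem_chart_source Plane (h x)
    obtain ⟨K, hK, hKsub, hKc⟩ := local_compact_nhds (x := x)
      (inter_mem (c.open_source.mem_nhds hxs)
        (hh.continuous.continuousAt.preimage_mem_nhds (d.open_source.mem_nhds hhx)))
    refine ⟨K, hK, residual_of_dense_open ?_ ?_⟩
    · exact ((hKc.inter_left hC).image hh.continuous).isClosed.isOpen_compl
    rw [← interior_eq_empty_iff_dense_compl]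
    by_contra hne
    have hsub : interior (h '' (C ∩ K)) ⊆ d.source := interior_subset.trans (by
      rintro _ ⟨p, hp, rfl⟩
      exact (hKsub hp.2).2)
    have hopen : IsOpen (d '' interior (h '' (C ∩ K))) :=
      d.isOpen_image_of_subset_source isOpen_interior hsub
    -- An interior point would give an open set of positive measure among the critical values, which
    -- form a null set in the chart because the determinant vanishes at critical points.
    have hpos := hopen.measure_pos volume ((nonempty_iff_ne_empty.2 hne).image d)
    have hzero : volume (chartRep c d h '' (c '' (C ∩ K))) = 0 := by
      refine addHaar_image_eq_zero_of_det_fderivWithin_eq_zero volume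
        (f' := fun w => fderiv ℝ (chartRep c d h) w) ?_ ?_
      · rintro _ ⟨p, hp, rfl⟩
        exact ((contDiffAt_chartRep hc hd hh.contMDiffAt (hKsub hp.2).1
          (hKsub hp.2).2).differentiableAt (by simp)).hasFDerivAt.hasFDerivWithinAt
      · rintro _ ⟨p, hp, rfl⟩
        by_contra h0
        exact hp.1 ((jac_ne_zero_iff_chartRep hc hd hh.contMDiffAt (hKsub hp.2).1
          (hKsub hp.2).2).2 h0)
    refine hpos.ne' (measure_mono_null ?_ hzero)
    rintro _ ⟨y, hy, rfl⟩
    obtain ⟨p, hp, rfl⟩ := interior_subset hy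
    exact ⟨c p, ⟨p, hp, rfl⟩, by simp [chartRep, c.left_inv (hKsub hp.2).1]⟩
  choose K hK hres using hloc
  obtain ⟨t, -, ht⟩ := isCompact_univ.elim_nhds_subcover K fun x _ => hK x
  have hev : ∀ᶠ y in residual N, ∀ x ∈ t, y ∉ h '' (C ∩ K x) :=
    (Finset.eventually_all t).2 fun x _ => hres x
  filter_upwards [hev] with y hy
  rw [isRegularValue_iff]
  rintro x rfl
  obtain ⟨p, hpt, hxp⟩ := mem_iUnion₂.1 (ht (mem_univ x))
  by_contra h0
  exact hy p hpt ⟨x, ⟨fun h1 => h1 h0, hxp⟩, rfl⟩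

theorem IsRegularValue.finite_preimage [CompactSpace M] [T1Space N]
    (hh : ContMDiff (𝓡 2) (𝓡 2) ∞ h) {y : N} (hy : IsRegularValue h y) : (h ⁻¹' {y}).Finite := by
  rw [isRegularValue_iff] at hy
  have hcpt : IsCompact (h ⁻¹' {y}) := (isClosed_singleton.preimage hh.continuous).isCompact
  choose! U hUo hxU hinj using fun x (hx : x ∈ h ⁻¹' {y}) =>
    exists_injOn_of_jac_ne_zero hh (hy x hx)
  obtain ⟨t, ht, hcov⟩ := hcpt.elim_nhds_subcover U fun x hx => (hUo x hx).mem_nhds (hxU x hx)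
  refine t.finite_toSet.subset fun p hp => ?_
  obtain ⟨x, hxt, hpx⟩ := mem_iUnion₂.1 (hcov hp)
  have : p = x := hinj x (ht x hxt) hpx (hxU x (ht x hxt)) (Eq.trans hp (ht x hxt).symm)
  exact this ▸ hxt

/-- Neighbourhoods on which `h` is injective surround the points over `y₀`. By compactness the image
of the remainder is closed and misses `y₀`, so a nearby fibre lies in these neighbourhoods, with at
most one point in each. -/
theorem IsRegularValue.eventually_encard_preimage_le [CompactSpace M] [T2Space N]
    (hh : ContMDiff (𝓡 2) (𝓡 2) ∞ h) {y₀ : N} (hy : IsRegularValue h y₀) :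
    ∀ᶠ y in 𝓝 y₀, (h ⁻¹' {y}).encard ≤ (h ⁻¹' {y₀}).encard := by
  rw [isRegularValue_iff] at hy
  choose! U hUo hxU hinj using fun x (hx : h x = y₀) =>
    exists_injOn_of_jac_ne_zero hh (hy x hx)
  let R : Set M := ⋃ x ∈ h ⁻¹' {y₀}, U x
  have hR : IsOpen R := isOpen_biUnion hUo
  have hcl : IsClosed (h '' Rᶜ) := (hR.isClosed_compl.isCompact.image hh.continuous).isClosed
  have hmem : y₀ ∉ h '' Rᶜ := by
    rintro ⟨x, hx, hxy⟩
    exact hx (mem_biUnion (show x ∈ h ⁻¹' {y₀} from hxy) (hxU x hxy))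
  filter_upwards [hcl.isOpen_compl.mem_nhds hmem] with y hy
  have hex : ∀ p ∈ h ⁻¹' {y}, ∃ x, h x = y₀ ∧ p ∈ U x := by
    intro p hp
    by_contra hne
    refine hy ⟨p, fun hpR => hne ?_, hp⟩
    obtain ⟨x, hx, hpx⟩ := mem_iUnion₂.1 hpR
    exact ⟨x, hx, hpx⟩
  choose! q hq hpq using hex
  refine encard_le_encard_of_injOn (f := q) (fun p hp => hq p hp) fun p hp p' hp' heq => ?_
  exact hinj (q p) (hq p hp) (hpq p hp) (heq ▸ hpq p' hp') (Eq.trans hp hp'.symm)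

end Jacobian

/-! ### The degree twisted by orientation characters, and its invariance under changes in a chart.
-/

section TwistedDegree

variable {M N : Type*}
  [TopologicalSpace M] [ChartedSpace (EuclideanSpace ℝ (Fin 2)) M]
  [TopologicalSpace N] [ChartedSpace (EuclideanSpace ℝ (Fin 2)) N]

/-- The sign `σ x`, which compares orientations at `x` and at `g x` in the preferred charts,
expressed in the charts `c` and `d`. -/
noncomputable def relSign (g : M → N) (σ : M → SignType) (c : OpenPartialHomeomorph M Plane)
    (d : OpenPartialHomeomorph N Plane) (x : M) : SignType :=
  σ x * (SignType.sign (jac c x) * SignType.sign (jac d (g x)))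

/-- `σ` is a continuous isomorphism from the orientation character of `M` to the pullback under `g`
of the orientation character of `N`. -/
structure IsOrientationLift (g : M → N) (σ : M → SignType) : Prop where
  ne_zero : ∀ x, σ x ≠ 0
  locally_const : ∀ c ∈ atlas Plane M, ∀ d ∈ atlas Plane N, ∀ x ∈ c.source, g x ∈ d.source →
    ∀ᶠ x' in 𝓝 x, relSign g σ c d x' = relSign g σ c d x

/-- The contribution of `x` to the signed count of the fibre over `y`. -/
noncomputable def pointIndex (g : M → N) (σ : M → SignType) (y : N) (x : M) : ℝ :=
  open Classical in if g x = y then ((σ x * SignType.sign (jac g x) : SignType) : ℝ) else 0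

/-- `g` has degree `k` with respect to some orientation lift, generically in the target. -/
def HasTwistedDegree (k : ℝ) (g : M → N) : Prop :=
  ∃ σ, IsOrientationLift g σ ∧
    ∀ᶠ y in residual N, IsRegularValue g y ∧ ∑ᶠ x, pointIndex g σ y x = k

theorem pointIndex_of_ne {g : M → N} {σ : M → SignType} {y : N} {x : M} (h : g x ≠ y) :
    pointIndex g σ y x = 0 := if_neg h

theorem SignType.mul_self_of_ne_zero (u : SignType) : u ≠ 0 → u * u = 1 := by decide +revert

theorem SignType.abs_coe_le (u : SignType) : |(u : ℝ)| ≤ 1 := by cases u <;> simp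

variable [IsManifold (𝓡 2) ∞ M] [IsManifold (𝓡 2) ∞ N]

section Move

variable {a a' : M → N} {σ : M → SignType} {c : OpenPartialHomeomorph M Plane}
  {d : OpenPartialHomeomorph N Plane} {W K : Set M} {s : SignType}

/-- The sign in charts `c`, `d` of a sign given in charts, turned back to the preferred charts. -/
noncomputable def signOfRel (g : M → N) (s : SignType) (c : OpenPartialHomeomorph M Plane)
    (d : OpenPartialHomeomorph N Plane) (x : M) : SignType :=
  s * (SignType.sign (jac c x) * SignType.sign (jac d (g x)))

theorem sign_mul_sign_ne_zero {g : M → N} {x : M} (hc : c ∈ atlas Plane M) (hd : d ∈ atlas Plane N)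
    (hx : x ∈ c.source) (hgx : g x ∈ d.source) :
    SignType.sign (jac c x) * SignType.sign (jac d (g x)) ≠ 0 :=
  mul_ne_zero (sign_ne_zero.2 (jac_chart_ne_zero hc hx)) (sign_ne_zero.2 (jac_chart_ne_zero hd hgx))

theorem relSign_eq_iff {g : M → N} {x : M} (hc : c ∈ atlas Plane M) (hd : d ∈ atlas Plane N)
    (hx : x ∈ c.source) (hgx : g x ∈ d.source) :
    relSign g σ c d x = s ↔ σ x = signOfRel g s c d x := by
  have key (u v w : SignType) : u ≠ 0 → (v * u = w ↔ v = w * u) := by decide +revert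
  exact key _ _ _ (sign_mul_sign_ne_zero hc hd hx hgx)

/-- A sign that is constant in one pair of charts is locally constant in every pair. -/
theorem eventually_relSign_eq_of_eventually_eq_signOfRel {g : M → N} {x : M}
    (hg : ContinuousAt g x) (hc : c ∈ atlas Plane M) (hd : d ∈ atlas Plane N)
    (hx : x ∈ c.source) (hgx : g x ∈ d.source)
    (hσ : ∀ᶠ x' in 𝓝 x, σ x' = signOfRel g s c d x')
    {c' : OpenPartialHomeomorph M Plane} {d' : OpenPartialHomeomorph N Plane}
    (hc' : c' ∈ atlas Plane M) (hd' : d' ∈ atlas Plane N) (hx' : x ∈ c'.source)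
    (hgx' : g x ∈ d'.source) :
    ∀ᶠ x' in 𝓝 x, relSign g σ c' d' x' = relSign g σ c' d' x := by
  have h0 := hσ.self_of_nhds
  filter_upwards [hσ, eventually_sign_jac_mul_eq hc hc' hx hx',
    hg.eventually (eventually_sign_jac_mul_eq hd hd' hgx hgx')] with p hp h1 h2
  simp only [relSign, hp, h0, signOfRel]
  calc _ = s * ((SignType.sign (jac c p) * SignType.sign (jac c' p)) *
        (SignType.sign (jac d (g p)) * SignType.sign (jac d' (g p)))) := by ac_rfl
    _ = _ := by rw [h1, h2]; ac_rfl

theorem relSign_eq_of_isPreconnected (hσ : IsOrientationLift a σ) (hc : c ∈ atlas Plane M)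
    (hd : d ∈ atlas Plane N) (hW : IsPreconnected W) (hWc : W ⊆ c.source)
    (haW : MapsTo a W d.source) :
    ∃ s, s ≠ 0 ∧ ∀ x ∈ W, relSign a σ c d x = s := by
  rcases W.eq_empty_or_nonempty with rfl | ⟨x₀, hx₀⟩
  · exact ⟨1, by decide, by simp⟩
  refine ⟨relSign a σ c d x₀, mul_ne_zero (hσ.ne_zero _)
    (sign_mul_sign_ne_zero hc hd (hWc hx₀) (haW hx₀)), fun x hx => ?_⟩
  refine hW.induction₂ (fun p q => relSign a σ c d p = relSign a σ c d q) (fun p hp => ?_)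
    (fun p q r _ _ _ h1 h2 => h1.trans h2) (fun p q _ _ h => h.symm) hx hx₀
  filter_upwards [mem_nhdsWithin_of_mem_nhds (hσ.locally_const c hc d hd p (hWc hp) (haW hp))]
    with q hq using hq.symm

/-- The chart signs enter once through `relSign` and once through the determinant, and cancel. -/
theorem pointIndex_eq_localIndex {g : M → N} {x : M} {y : N} (hc : c ∈ atlas Plane M)
    (hd : d ∈ atlas Plane N) (hg : ContMDiffAt (𝓡 2) (𝓡 2) ∞ g x) (hx : x ∈ c.source)
    (hgx : g x ∈ d.source) (hy : y ∈ d.source) :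
    pointIndex g σ y x = (relSign g σ c d x : ℝ) *
      Plane.localIndex (chartRep c d g) (d y) (c x) := by
  have h1 : chartRep c d g (c x) = d (g x) := by simp [chartRep, c.left_inv hx]
  have h2 := sign_jac_eq hc hd hg hx hgx
  have h3 := sign_mul_sign_ne_zero hc hd hx hgx
  by_cases h : g x = y
  · rw [pointIndex, if_pos h, Plane.localIndex, if_pos (by rw [h1, h]), ← h2, relSign]
    have key (u v w : SignType) : u ≠ 0 → v * w = (v * u) * (u * w) := by decide +revert
    rw [← SignType.coe_mul, ← key _ _ _ h3]
  · rw [pointIndex_of_ne h, Plane.localIndex_of_ne, mul_zero]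
    rw [h1]
    exact fun h' => h (d.injOn hgx hy h')

theorem finsum_mem_pointIndex_eq {g : M → N} {y : N} (hc : c ∈ atlas Plane M)
    (hd : d ∈ atlas Plane N) (hg : ContMDiff (𝓡 2) (𝓡 2) ∞ g) (hK : K ⊆ c.source)
    (hgK : MapsTo g K d.source) (hs : ∀ x ∈ K, relSign g σ c d x = s) (hy : y ∈ d.source) :
    ∑ᶠ x ∈ K, pointIndex g σ y x =
      (s : ℝ) * ∑ᶠ w ∈ c '' K, Plane.localIndex (chartRep c d g) (d y) w := by
  rw [finsum_mem_image (c.injOn.mono hK), ← smul_eq_mul, smul_finsum]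
  refine finsum_congr fun x => ?_
  by_cases hx : x ∈ K
  · simp [hx, pointIndex_eq_localIndex hc hd hg.contMDiffAt (hK hx) (hgK hx) hy, hs x hx]
  · simp [hx]

variable [CompactSpace M] [T2Space N]

theorem finsum_pointIndex_eq_add {g : M → N} {y : N} (hg : ContMDiff (𝓡 2) (𝓡 2) ∞ g)
    (hy : IsRegularValue g y) (K : Set M) :
    ∑ᶠ x, pointIndex g σ y x = ∑ᶠ x ∈ K, pointIndex g σ y x + ∑ᶠ x ∈ Kᶜ, pointIndex g σ y x := by
  have hfin : (Function.support (pointIndex g σ y)).Finite :=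
    (hy.finite_preimage hg).subset fun x hx => by
      by_contra h
      exact hx (pointIndex_of_ne h)
  rw [← finsum_mem_univ, ← union_compl_self K]
  exact finsum_mem_union' disjoint_compl_right (hfin.subset inter_subset_right)
    (hfin.subset inter_subset_right)

/-- The twisted degree does not change when the map is changed inside a chart. -/
theorem HasTwistedDegree.of_eq_off_compact [T2Space M] {k : ℝ} (ha : ContMDiff (𝓡 2) (𝓡 2) ∞ a)
    (ha' : ContMDiff (𝓡 2) (𝓡 2) ∞ a') (hc : c ∈ atlas Plane M) (hd : d ∈ atlas Plane N)
    (hWo : IsOpen W) (hW : IsPreconnected W) (hWc : W ⊆ c.source) (hK : IsCompact K) (hKW : K ⊆ W)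
    (haW : MapsTo a W d.source) (haW' : MapsTo a' W d.source) (heq : ∀ x ∉ K, a x = a' x)
    (h : HasTwistedDegree k a) : HasTwistedDegree k a' := by
  classical
  obtain ⟨σ, hσ, hk⟩ := h
  obtain ⟨s, hs0, hs⟩ := relSign_eq_of_isPreconnected hσ hc hd hW hWc haW
  -- On `W` the lift keeps the constant sign `s` in the charts `c`, `d`; its values must be
  -- recomputed since `a' x` may have another preferred chart than `a x`. Off `K` nothing changes.
  let σ' : M → SignType := fun x => if x ∈ W then signOfRel a' s c d x else σ x
  have hσW : ∀ x ∈ W, σ' x = signOfRel a' s c d x := fun x hx => if_pos hx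
  have hσK : ∀ x ∉ K, σ' x = σ x := by
    intro x hx
    by_cases hxW : x ∈ W
    · rw [hσW x hxW, (relSign_eq_iff hc hd (hWc hxW) (haW hxW)).1 (hs x hxW), signOfRel, signOfRel,
        heq x hx]
    · exact if_neg hxW
  have hnear : ∀ x ∉ K, a =ᶠ[𝓝 x] a' := fun x hx => by
    filter_upwards [hK.isClosed.isOpen_compl.mem_nhds hx] with y hy using heq y hy
  have hσnear : ∀ x ∉ K, σ' =ᶠ[𝓝 x] σ := fun x hx => by
    filter_upwards [hK.isClosed.isOpen_compl.mem_nhds hx] with y hy using hσK y hy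
  refine ⟨σ', ⟨fun x => ?_, fun c' hc' d' hd' x hx hax => ?_⟩, ?_⟩
  · by_cases hxW : x ∈ W
    · rw [hσW x hxW]
      exact mul_ne_zero hs0 (sign_mul_sign_ne_zero hc hd (hWc hxW) (haW' hxW))
    · rw [hσK x fun h => hxW (hKW h)]
      exact hσ.ne_zero x
  · by_cases hxW : x ∈ W
    · refine eventually_relSign_eq_of_eventually_eq_signOfRel (s := s) ha'.continuous.continuousAt
        hc hd (hWc hxW) (haW' hxW) ?_ hc' hd' hx hax
      filter_upwards [hWo.mem_nhds hxW] with y hy using hσW y hy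
    · have hxK : x ∉ K := fun h => hxW (hKW h)
      filter_upwards [hσ.locally_const c' hc' d' hd' x hx (by rwa [heq x hxK]), hnear x hxK,
        hσnear x hxK] with y h1 h2 h3
      simp only [relSign] at h1 ⊢
      rw [h3, ← h2, h1, hσK x hxK, heq x hxK]
  · filter_upwards [hk, eventually_residual_isRegularValue ha'] with y ⟨hreg, hcount⟩ hreg'
    refine ⟨hreg', ?_⟩
    rw [← hcount, finsum_pointIndex_eq_add ha' hreg' K, finsum_pointIndex_eq_add ha hreg K]
    congr 1
    · by_cases hy : y ∈ d.source
      · rw [finsum_mem_pointIndex_eq hc hd ha (hKW.trans hWc) (haW.mono_left hKW)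
          (fun x hx => hs x (hKW hx)) hy,
          finsum_mem_pointIndex_eq hc hd ha' (hKW.trans hWc) (haW'.mono_left hKW)
          (fun x hx => (relSign_eq_iff hc hd (hWc (hKW hx)) (haW' (hKW hx))).2
            (hσW x (hKW hx))) hy]
        congr 1
        have hsmooth {b : M → N} (hb : ContMDiff (𝓡 2) (𝓡 2) ∞ b) (hbW : MapsTo b W d.source) :
            ∀ w ∈ c '' W, ContDiffAt ℝ 2 (chartRep c d b) w := by
          rintro _ ⟨x, hx, rfl⟩
          exact (contDiffAt_chartRep hc hd hb.contMDiffAt (hWc hx) (hbW hx)).of_le two_le_infty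
        have hregular {b : M → N} (hb : ContMDiff (𝓡 2) (𝓡 2) ∞ b) (hbW : MapsTo b W d.source)
            (hby : IsRegularValue b y) : ∀ w ∈ c '' K, chartRep c d b w = d y →
            (fderiv ℝ (chartRep c d b) w).det ≠ 0 := by
          rintro _ ⟨x, hx, rfl⟩ hxy
          refine (jac_ne_zero_iff_chartRep hc hd hb.contMDiffAt (hWc (hKW hx)) (hbW (hKW hx))).1
            (isRegularValue_iff.1 hby x (d.injOn (hbW (hKW hx)) hy ?_))
          simpa [chartRep, c.left_inv (hWc (hKW hx))] using hxy
        refine Plane.finsum_localIndex_eq (W := c '' W) (c.isOpen_image_of_subset_source hWo hWc)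
          (hK.image_of_continuousOn (c.continuousOn.mono (hKW.trans hWc))) (image_mono hKW)
          (hsmooth ha' haW') (hsmooth ha haW) ?_ (hregular ha' haW' hreg') (hregular ha haW hreg)
        rintro _ ⟨⟨x, hx, rfl⟩, hxK⟩
        simp [chartRep, c.left_inv (hWc hx), heq x fun h => hxK ⟨x, h, rfl⟩]
      · have hzero {b : M → N} {τ : M → SignType} (hbW : MapsTo b W d.source) :
            ∑ᶠ x ∈ K, pointIndex b τ y x = 0 :=
          finsum_mem_eq_zero_of_forall_eq_zero fun x hx => pointIndex_of_ne fun h =>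
            hy (h ▸ hbW (hKW hx))
        rw [hzero haW, hzero haW']
    · refine finsum_mem_congr rfl fun x hx => ?_
      simp only [pointIndex, hσK x hx, heq x hx, jac_congr (hnear x hx)]

end Move

/-- Every regular fibre has at least as many points as the twisted degree. -/
theorem HasTwistedDegree.le_encard [CompactSpace M] [CompactSpace N] [T2Space N] {k : ℕ} {h : M → N}
    (hk : HasTwistedDegree k h) (hh : ContMDiff (𝓡 2) (𝓡 2) ∞ h) {y₀ : N}
    (hy₀ : IsRegularValue h y₀) : (k : ℕ∞) ≤ (h ⁻¹' {y₀}).encard := by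
  obtain ⟨σ, -, hres⟩ := hk
  have hdense := dense_of_mem_residual hres
  -- The count is known only for generic values, so `y₀` is replaced by a generic `y` whose fibre is
  -- no larger.
  obtain ⟨y, hyle, hreg, hcount⟩ :=
    mem_closure_iff_nhds.1 (hdense y₀) _ (hy₀.eventually_encard_preimage_le hh)
  refine le_trans ?_ hyle
  have hfin := hreg.finite_preimage hh
  rw [hfin.encard_eq_coe_toFinset_card]
  have h1 : ∑ᶠ x, pointIndex h σ y x = ∑ x ∈ hfin.toFinset, pointIndex h σ y x := by
    refine finsum_eq_sum_of_support_subset _ fun x hx => ?_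
    by_contra hne
    exact hx (pointIndex_of_ne fun h => hne (by simpa using h))
  have h2 : (k : ℝ) ≤ hfin.toFinset.card := by
    calc (k : ℝ) ≤ |∑ x ∈ hfin.toFinset, pointIndex h σ y x| := by
          rw [← h1, hcount]
          exact le_abs_self _
      _ ≤ ∑ x ∈ hfin.toFinset, |pointIndex h σ y x| := Finset.abs_sum_le_sum_abs _ _
      _ ≤ ∑ x ∈ hfin.toFinset, 1 := Finset.sum_le_sum fun x _ => by
          by_cases hxy : h x = y
          · rw [pointIndex, if_pos hxy]
            exact SignType.abs_coe_le _
          · simp [pointIndex_of_ne hxy]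
      _ = _ := by simp
  exact_mod_cast h2

end TwistedDegree

/-! ### Local homeomorphisms, branched coverings and their orientation lifts. -/

section LocalHomeo

variable {M N : Type*} [TopologicalSpace M] [TopologicalSpace N]

/-- The points near which `f` is a homeomorphism onto an open set. -/
def localHomeoSet (f : M → N) : Set M :=
  {x | ∃ e : OpenPartialHomeomorph M N, x ∈ e.source ∧ EqOn f e e.source}

theorem isOpen_localHomeoSet (f : M → N) : IsOpen (localHomeoSet f) := by
  rw [isOpen_iff_mem_nhds]
  rintro x ⟨e, hx, he⟩
  filter_upwards [e.open_source.mem_nhds hx] with y hy using ⟨e, hy, he⟩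

theorem IsLocalHomeomorphOn.subset_localHomeoSet {f : M → N} {S : Set M}
    (hf : IsLocalHomeomorphOn f S) : S ⊆ localHomeoSet f := by
  intro x hx
  obtain ⟨e, hxe, he⟩ := hf x hx
  exact ⟨e, hxe, fun y _ => congrFun he y⟩

end LocalHomeo

section BranchedCovering

variable {M N : Type*}
  [TopologicalSpace M] [ChartedSpace (EuclideanSpace ℝ (Fin 2)) M]
  [TopologicalSpace N] [ChartedSpace (EuclideanSpace ℝ (Fin 2)) N]

theorem neBot_nhdsNE_surface [T1Space M] (x : M) : (𝓝[≠] x).NeBot := by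
  rw [neBot_iff]
  intro h
  rw [← isOpen_singleton_iff_punctured_nhds] at h
  have h1 : IsOpen (chartAt Plane x '' {x}) :=
    (chartAt Plane x).isOpen_image_of_subset_source h (by simp)
  rw [image_singleton] at h1
  exact not_isOpen_singleton _ h1

/-- `B` need not be closed, but second countability makes it countable, and each single point is
closed with dense complement. -/
theorem IsDiscrete.compl_mem_residual [T1Space N] [SecondCountableTopology N] {B : Set N}
    (hB : IsDiscrete B) : Bᶜ ∈ residual N := by
  have hc : B.Countable := (HereditarilyLindelofSpace.isLindelof B).countable hB.to_subtype
  have h1 : ∀ᶠ y in residual N, ∀ b ∈ B, y ≠ b := by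
    refine (eventually_countable_ball hc).2 fun b _ => ?_
    have := neBot_nhdsNE_surface b
    exact residual_of_dense_open isOpen_compl_singleton (dense_compl_singleton b)
  filter_upwards [h1] with y hy hyB using hy y hyB rfl

/-- Near `x` the map `f` has sign `s` in the charts `c`, `d` wherever it is regular. -/
def HasLocalSign (f : M → N) (c : OpenPartialHomeomorph M Plane)
    (d : OpenPartialHomeomorph N Plane) (s : SignType) (x : M) : Prop :=
  ∀ᶠ p in 𝓝 x, jac f p ≠ 0 →
    SignType.sign (jac c p) * SignType.sign (jac d (f p)) * SignType.sign (jac f p) = s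

variable {f : M → N} {c : OpenPartialHomeomorph M Plane} {d : OpenPartialHomeomorph N Plane}
  {s : SignType} {x : M}

theorem HasLocalSign.eq {s' : SignType} (h : HasLocalSign f c d s x)
    (h' : HasLocalSign f c d s' x) (hreg : ∃ᶠ p in 𝓝 x, jac f p ≠ 0) : s = s' := by
  obtain ⟨p, hp, h1, h2⟩ := (hreg.and_eventually (h.and h')).exists
  exact (h1 hp).symm.trans (h2 hp)

variable [IsManifold (𝓡 2) ∞ M] [IsManifold (𝓡 2) ∞ N]

theorem hasLocalSign_of_jac_ne_zero (hf : ContMDiff (𝓡 2) (𝓡 2) ∞ f) (hc : c ∈ atlas Plane M)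
    (hd : d ∈ atlas Plane N) (hx : x ∈ c.source) (hfx : f x ∈ d.source) (h0 : jac f x ≠ 0) :
    ∃ s, s ≠ 0 ∧ HasLocalSign f c d s x := by
  have hcont := Plane.continuousAt_det_fderiv
    ((contDiffAt_chartRep hc hd hf.contMDiffAt hx hfx).of_le two_le_infty)
  have hdet := (jac_ne_zero_iff_chartRep hc hd hf.contMDiffAt hx hfx).1 h0
  refine ⟨_, sign_ne_zero.2 hdet, ?_⟩
  filter_upwards [(c.continuousAt hx).eventually (hcont.eventually_sign_eq hdet),
    c.open_source.mem_nhds hx,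
    hf.continuous.continuousAt.preimage_mem_nhds (d.open_source.mem_nhds hfx)] with p h1 h2 h3 _
  rw [sign_jac_eq hc hd hf.contMDiffAt h2 h3, h1]

/-- A smooth local homeomorphism may have critical points, so continuity of the determinant is not
enough; `Plane.eventually_sign_det_eq` compares the regular points around them. -/
theorem hasLocalSign_of_mem_localHomeoSet (hf : ContMDiff (𝓡 2) (𝓡 2) ∞ f)
    (hreg : ∃ᶠ p in 𝓝 x, jac f p ≠ 0) (hc : c ∈ atlas Plane M)
    (hd : d ∈ atlas Plane N) (hx : x ∈ c.source) (hfx : f x ∈ d.source)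
    (hxf : x ∈ localHomeoSet f) : ∃ s, s ≠ 0 ∧ HasLocalSign f c d s x := by
  obtain ⟨e, hxe, he⟩ := hxf
  let e' : OpenPartialHomeomorph Plane Plane := (c.symm.trans e).trans d
  have hmem : ∀ w ∈ e'.source, w ∈ c.target ∧ c.symm w ∈ e.source ∧ f (c.symm w) ∈ d.source := by
    intro w hw
    simp only [e', OpenPartialHomeomorph.trans_source, mem_inter_iff, mem_preimage,
      OpenPartialHomeomorph.symm_source, OpenPartialHomeomorph.coe_trans,
      Function.comp_apply] at hw
    exact ⟨hw.1.1, hw.1.2, by rw [he hw.1.2]; exact hw.2⟩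
  have hxe' : c x ∈ e'.source := by
    simp only [e', OpenPartialHomeomorph.trans_source, mem_inter_iff, mem_preimage,
      OpenPartialHomeomorph.symm_source, OpenPartialHomeomorph.coe_trans,
      Function.comp_apply, c.left_inv hx, ← he hxe]
    exact ⟨⟨c.map_source hx, hxe⟩, hfx⟩
  obtain ⟨U, hU, hsign⟩ := Plane.eventually_sign_det_eq (F := chartRep c d f) e' hxe'
    (fun w hw => by simp [e', chartRep, he (hmem w hw).2.1])
    (fun w hw => by
      have := contDiffAt_chartRep hc hd hf.contMDiffAt (c.map_target (hmem w hw).1) (hmem w hw).2.2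
      rw [c.right_inv (hmem w hw).1] at this
      exact this.of_le two_le_infty)
  have hev : ∀ᶠ p in 𝓝 x, c p ∈ U ∧ p ∈ c.source ∧ f p ∈ d.source :=
    ((c.continuousAt hx).eventually hU).and ((c.open_source.eventually_mem hx).and
      (hf.continuous.continuousAt.preimage_mem_nhds (d.open_source.mem_nhds hfx)))
  obtain ⟨p, hp0, hpU, hpc, hpd⟩ := (hreg.and_eventually hev).exists
  have hp := (jac_ne_zero_iff_chartRep hc hd hf.contMDiffAt hpc hpd).1 hp0
  refine ⟨_, sign_ne_zero.2 hp, ?_⟩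
  filter_upwards [hev] with q ⟨hqU, hqc, hqd⟩ hq0
  rw [sign_jac_eq hc hd hf.contMDiffAt hqc hqd]
  exact hsign _ hqU _ hpU ((jac_ne_zero_iff_chartRep hc hd hf.contMDiffAt hqc hqd).1 hq0) hp

/-- A homeomorphism of the plane onto the disc carries the punctured plane to the punctured disc. -/
theorem Plane.isPreconnected_ball_sdiff_singleton (z : Plane) {r : ℝ} (hr : 0 < r) :
    IsPreconnected (Metric.ball z r \ {z}) := by
  have hrank : 1 < Module.rank ℝ Plane := by
    rw [← Module.finrank_eq_rank, finrank_euclideanSpace_fin]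
    norm_num
  have h1 := (isConnected_compl_singleton_of_one_lt_rank hrank (0 : Plane)).isPreconnected
  have h2 := h1.image (OpenPartialHomeomorph.univBall z r)
    (OpenPartialHomeomorph.continuous_univBall z r).continuousOn
  convert h2 using 1
  have h3 : (OpenPartialHomeomorph.univBall z r) '' univ = Metric.ball z r := by
    rw [← OpenPartialHomeomorph.univBall_target z hr, ← OpenPartialHomeomorph.image_source_eq_target,
      OpenPartialHomeomorph.univBall_source]
  have h4 : Function.Injective (OpenPartialHomeomorph.univBall z r) := by
    rw [← injOn_univ, ← OpenPartialHomeomorph.univBall_source z r]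
    exact (OpenPartialHomeomorph.univBall z r).injOn
  rw [compl_eq_univ_sdiff, image_sdiff h4, h3, image_singleton,
    OpenPartialHomeomorph.univBall_apply_zero]

/-- Around a critical `x`, a punctured disc consists of points of local homeomorphism, and the local
sign is constant there by connectedness. The centre, being critical, imposes no condition. -/
theorem exists_hasLocalSign (hf : ContMDiff (𝓡 2) (𝓡 2) ∞ f)
    (hreg : ∀ x, ∃ᶠ p in 𝓝 x, jac f p ≠ 0) (hpunct : ∀ x, ∀ᶠ p in 𝓝[≠] x, p ∈ localHomeoSet f)
    (hc : c ∈ atlas Plane M) (hd : d ∈ atlas Plane N) (hx : x ∈ c.source) (hfx : f x ∈ d.source) :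
    ∃ s, s ≠ 0 ∧ HasLocalSign f c d s x := by
  by_cases h0 : jac f x ≠ 0
  · exact hasLocalSign_of_jac_ne_zero hf hc hd hx hfx h0
  rw [not_not] at h0
  have hev : ∀ᶠ p in 𝓝 x, (p ≠ x → p ∈ localHomeoSet f) ∧ f p ∈ d.source :=
    (eventually_nhdsWithin_iff.1 (hpunct x)).and
      (hf.continuous.continuousAt.preimage_mem_nhds (d.open_source.mem_nhds hfx))
  have hev' : ∀ᶠ w in 𝓝 (c x), w ∈ c.target ∧
      (c.symm w ≠ x → c.symm w ∈ localHomeoSet f) ∧ f (c.symm w) ∈ d.source := by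
    refine (c.open_target.eventually_mem (c.map_source hx)).and ?_
    have h1 := c.continuousAt_symm (c.map_source hx)
    rw [ContinuousAt, c.left_inv hx] at h1
    exact h1.eventually hev
  obtain ⟨r, hr, hball⟩ := Metric.eventually_nhds_iff_ball.1 hev'
  let Y : Set M := c.symm '' (Metric.ball (c x) r \ {c x})
  have hYpre : IsPreconnected Y := (Plane.isPreconnected_ball_sdiff_singleton (c x) hr).image _
    (c.continuousOn_symm.mono fun w hw => (hball w hw.1).1)
  have hY : ∀ p ∈ Y, p ∈ localHomeoSet f ∧ p ∈ c.source ∧ f p ∈ d.source := by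
    rintro _ ⟨w, hw, rfl⟩
    obtain ⟨h1, h2, h3⟩ := hball w hw.1
    refine ⟨h2 fun h => hw.2 ?_, c.map_target h1, h3⟩
    rw [mem_singleton_iff, ← h, c.right_inv h1]
  choose! s hs0 hs using fun p (hp : p ∈ Y) => hasLocalSign_of_mem_localHomeoSet hf (hreg p) hc hd
    (hY p hp).2.1 (hY p hp).2.2 (hY p hp).1
  have hconst : ∀ p ∈ Y, ∀ q ∈ Y, s p = s q := by
    intro p hp q hq
    refine hYpre.induction₂ (fun p q => s p = s q) (fun p hp => ?_)
      (fun p q r _ _ _ h1 h2 => h1.trans h2) (fun p q _ _ h => h.symm) hp hq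
    filter_upwards [mem_nhdsWithin_of_mem_nhds (hs p hp).eventually_nhds, self_mem_nhdsWithin]
      with q hq hqY
    exact HasLocalSign.eq hq (hs q hqY) (hreg q)
  have hnear : ∀ᶠ p in 𝓝 x, p ≠ x → p ∈ Y := by
    filter_upwards [c.open_source.mem_nhds hx,
      (c.continuousAt hx).preimage_mem_nhds (Metric.ball_mem_nhds _ hr)] with p hp1 hp2 hpx
    exact ⟨c p, ⟨hp2, fun h => hpx (c.injOn hp1 hx h)⟩, c.left_inv hp1⟩
  obtain ⟨p, hp0, hpY⟩ := ((hreg x).and_eventually hnear).exists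
  have hp : p ∈ Y := hpY fun h => hp0 (h ▸ h0)
  refine ⟨s p, hs0 p hp, ?_⟩
  filter_upwards [hnear] with q hqY hq0
  have hq : q ∈ Y := hqY fun h => hq0 (h ▸ h0)
  rw [hconst p hp q hq]
  exact (hs q hq).self_of_nhds hq0

/-- A map that is a local homeomorphism off a discrete set pulls the orientation character of the
target back to that of the source, in such a way that it is everywhere orientation preserving. -/
theorem exists_isOrientationLift (hf : ContMDiff (𝓡 2) (𝓡 2) ∞ f)
    (hreg : ∀ x, ∃ᶠ p in 𝓝 x, jac f p ≠ 0) (hpunct : ∀ x, ∀ᶠ p in 𝓝[≠] x, p ∈ localHomeoSet f) :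
    ∃ σ, IsOrientationLift f σ ∧ ∀ x, jac f x ≠ 0 → σ x * SignType.sign (jac f x) = 1 := by
  choose s hs0 hs using fun x => exists_hasLocalSign hf hreg hpunct (chart_mem_atlas Plane x)
    (chart_mem_atlas Plane (f x)) (mem_chart_source Plane x) (mem_chart_source Plane (f x))
  let σ : M → SignType := fun x => signOfRel f (s x) (chartAt Plane x) (chartAt Plane (f x)) x
  refine ⟨σ, ⟨fun x => ?_, fun c hc d hd x₀ hx₀ hfx₀ => ?_⟩, fun x hx => ?_⟩
  · exact mul_ne_zero (hs0 x) (sign_mul_sign_ne_zero (chart_mem_atlas Plane x)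
      (chart_mem_atlas Plane (f x)) (mem_chart_source Plane x) (mem_chart_source Plane (f x)))
  · obtain ⟨s₀, hs₀0, hs₀⟩ := exists_hasLocalSign hf hreg hpunct hc hd hx₀ hfx₀
    refine eventually_relSign_eq_of_eventually_eq_signOfRel (s := s₀) hf.continuous.continuousAt
      hc hd hx₀ hfx₀ ?_ hc hd hx₀ hfx₀
    filter_upwards [hs₀.eventually_nhds, c.open_source.mem_nhds hx₀,
      hf.continuous.continuousAt.preimage_mem_nhds (d.open_source.mem_nhds hfx₀)] with x h1 h2 h3
    -- Since `x` may be critical, the sign `s₀` and the sign `s x` are compared at a regular point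
    -- `p` close to `x`.
    obtain ⟨p, hp0, hp1, hp2, hp3, hp4⟩ := ((hreg x).and_eventually (h1.and ((hs x).and
      ((eventually_sign_jac_mul_eq hc (chart_mem_atlas Plane x) h2 (mem_chart_source Plane x)).and
      (hf.continuous.continuousAt.eventually (eventually_sign_jac_mul_eq hd
        (chart_mem_atlas Plane (f x)) h3 (mem_chart_source Plane (f x)))))))).exists
    have key (C C' D D' u : SignType) :
        C' * D' * u ≠ 0 → C' * D' * u * ((C * C') * (D * D')) = C * D * u := by decide +revert
    have hσ : relSign f σ c d x = s₀ := by
      have h5 := key (SignType.sign (jac c p)) (SignType.sign (jac (chartAt Plane x) p))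
        (SignType.sign (jac d (f p))) (SignType.sign (jac (chartAt Plane (f x)) (f p)))
        (SignType.sign (jac f p)) (by rw [hp2 hp0]; exact hs0 x)
      rw [hp2 hp0, hp1 hp0, hp3, hp4] at h5
      rw [← h5]
      simp only [relSign, σ, signOfRel]
      ac_rfl
    exact (relSign_eq_iff hc hd h2 h3).1 hσ
  · have h1 := (hs x).self_of_nhds hx
    have h2 := SignType.mul_self_of_ne_zero _ (hs0 x)
    simp only [σ, signOfRel]
    rw [mul_assoc, h1, h2]

variable [CompactSpace M] [T2Space M] [T2Space N] [CompactSpace N]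

/-- With the lift of `exists_isOrientationLift` every regular point counts `+1`, and a generic value
is regular and off `B`, so the count is the number of sheets. -/
theorem IsBranchedCovering.hasTwistedDegree {k : ℕ} (hf : ContMDiff (𝓡 2) (𝓡 2) ∞ f)
    (hk : IsBranchedCovering k f) : HasTwistedDegree k f := by
  obtain ⟨B, hB, hfB, hcov, hcard⟩ := hk
  have : SecondCountableTopology N := ChartedSpace.secondCountable_of_sigmaCompact Plane N
  have hsub := hcov.isLocalHomeomorphOn.subset_localHomeoSet
  have hpunct (x : M) : ∀ᶠ p in 𝓝[≠] x, p ∈ localHomeoSet f := by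
    by_cases hx : f x ∈ B
    · have h1 : ∀ᶠ p in 𝓝[f ⁻¹' B] x, p = x := by
        rw [isDiscrete_iff_nhdsWithin.1 hfB x hx]
        exact eventually_pure.2 rfl
      rw [eventually_nhdsWithin_iff] at h1 ⊢
      filter_upwards [h1] with p hp hpx using hsub fun h => hpx (hp h)
    · exact mem_nhdsWithin_of_mem_nhds ((isOpen_localHomeoSet f).mem_nhds (hsub hx))
  have hsard := eventually_residual_isRegularValue hf
  -- Otherwise an open set of critical points would contain a point of local homeomorphism, and its
  -- image would be a neighbourhood free of regular values, against Sard.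
  have hreg (x : M) : ∃ᶠ p in 𝓝 x, jac f p ≠ 0 := by
    intro hev
    have := neBot_nhdsNE_surface x
    obtain ⟨p, ⟨e, hpe, he⟩, hp⟩ :=
      ((hpunct x).and (mem_nhdsWithin_of_mem_nhds hev.eventually_nhds)).exists
    have h1 : f '' {q | q ∈ e.source ∧ jac f q = 0} ∈ 𝓝 (f p) := by
      rw [he hpe, ← e.map_nhds_eq hpe, (he.mono fun q hq => hq.1).image_eq]
      exact image_mem_map (inter_mem (e.open_source.mem_nhds hpe)
        (hp.mono fun q hq => not_not.1 hq))
    obtain ⟨y, ⟨q, hq, rfl⟩, hy⟩ :=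
      mem_closure_iff_nhds.1 (dense_of_mem_residual hsard (f p)) _ h1
    exact isRegularValue_iff.1 hy q rfl hq.2
  obtain ⟨σ, hσ, hone⟩ := exists_isOrientationLift hf hreg hpunct
  refine ⟨σ, hσ, ?_⟩
  filter_upwards [hsard, hB.compl_mem_residual] with y hy hyB
  refine ⟨hy, ?_⟩
  have hfin := hy.finite_preimage hf
  have h1 : ∑ᶠ x, pointIndex f σ y x = ∑ x ∈ hfin.toFinset, pointIndex f σ y x := by
    refine finsum_eq_sum_of_support_subset _ fun x hx => ?_
    by_contra hne
    exact hx (pointIndex_of_ne fun h => hne (by simpa using h))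
  have h2 : ∀ x ∈ hfin.toFinset, pointIndex f σ y x = 1 := by
    intro x hx
    have hxy : f x = y := by simpa using hx
    rw [pointIndex, if_pos hxy, hone x (isRegularValue_iff.1 hy x hxy), SignType.coe_one]
  have h3 := hcard y hyB
  rw [hfin.encard_eq_coe_toFinset_card] at h3
  rw [h1, Finset.sum_congr rfl h2, Finset.sum_const, nsmul_one]
  exact_mod_cast h3

end BranchedCovering

/-! ### Interpolation in charts. -/

/-- The data for modifying maps `M → N` inside a chart of `M`, by interpolation in a chart
of `N`. -/
structure ChartPatch (M N : Type*)
    [TopologicalSpace M] [ChartedSpace (EuclideanSpace ℝ (Fin 2)) M]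
    [TopologicalSpace N] [ChartedSpace (EuclideanSpace ℝ (Fin 2)) N] where
  /-- the chart of the source -/
  c : OpenPartialHomeomorph M Plane
  /-- the chart of the target -/
  d : OpenPartialHomeomorph N Plane
  /-- a connected neighbourhood of the support of the modification -/
  W : Set M
  /-- a compact set on which the maps have values in the chart of the target -/
  L : Set M
  /-- a convex set in which the interpolation takes place -/
  Ω : Set Plane
  /-- the weight of the new map -/
  ψ : M → ℝ
  /-- a cutoff function -/
  φ : M → ℝ
  hc : c ∈ atlas Plane M
  hd : d ∈ atlas Plane N
  isOpen_W : IsOpen W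
  isPreconnected_W : IsPreconnected W
  isCompact_L : IsCompact L
  W_subset : W ⊆ L
  L_subset : L ⊆ c.source
  isOpen_Ω : IsOpen Ω
  convex_Ω : Convex ℝ Ω
  Ω_subset : Ω ⊆ d.target
  ψ_smooth : ContMDiff (𝓡 2) 𝓘(ℝ, ℝ) ∞ ψ
  ψ_mem : ∀ x, ψ x ∈ Icc (0 : ℝ) 1
  tsupport_ψ : tsupport ψ ⊆ W
  φ_smooth : ContMDiff (𝓡 2) 𝓘(ℝ, ℝ) ∞ φ
  tsupport_φ : tsupport φ ⊆ W
  φ_one : ∀ x ∈ tsupport ψ, φ x = 1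

namespace ChartPatch

variable {M N : Type*}
  [TopologicalSpace M] [ChartedSpace (EuclideanSpace ℝ (Fin 2)) M]
  [TopologicalSpace N] [ChartedSpace (EuclideanSpace ℝ (Fin 2)) N]
  (p : ChartPatch M N)

/-- The part of the target in which the interpolation takes place. -/
def V : Set N := p.d.source ∩ p.d ⁻¹' p.Ω

theorem isOpen_V : IsOpen p.V := p.d.isOpen_inter_preimage p.isOpen_Ω

/-- Interpolation between a map to `N` and a map to the plane. -/
noncomputable def interp (a : M → N) (ξ : M → Plane) (x : M) : N :=
  open Classical in
  if p.ψ x = 0 then a x else p.d.symm ((1 - p.ψ x) • p.d (a x) + p.ψ x • ξ x)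

/-- The expression of a map in the chart of the target, cut off outside the patch. -/
noncomputable def cutoff (b : M → N) (x : M) : Plane := p.φ x • p.d (b x)

variable {p} {a b : M → N} {ξ : M → Plane} {x : M}

theorem interp_of_eq_zero (h : p.ψ x = 0) : p.interp a ξ x = a x := if_pos h

/-- The separate case `ψ x = 0` guards only against `a x` outside the target chart; inside it, the
formula already returns `a x`. -/
theorem interp_of_mem_source (h : a x ∈ p.d.source) :
    p.interp a ξ x = p.d.symm ((1 - p.ψ x) • p.d (a x) + p.ψ x • ξ x) := by
  by_cases h0 : p.ψ x = 0
  · rw [interp_of_eq_zero h0, h0]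
    simp [p.d.left_inv h]
  · exact if_neg h0

theorem interp_of_eq_one (h : p.ψ x = 1) : p.interp a ξ x = p.d.symm (ξ x) := by
  rw [interp, if_neg (by rw [h]; exact one_ne_zero), h]
  simp

theorem interpolant_mem (ha : MapsTo a p.L p.V) (hξ : MapsTo ξ (tsupport p.ψ) p.Ω) (hx : x ∈ p.W) :
    (1 - p.ψ x) • p.d (a x) + p.ψ x • ξ x ∈ p.Ω := by
  have h1 := (ha (p.W_subset hx)).2
  by_cases h0 : p.ψ x = 0
  · simpa [h0] using h1
  · exact p.convex_Ω h1 (hξ (subset_tsupport _ h0)) (sub_nonneg.2 (p.ψ_mem x).2) (p.ψ_mem x).1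
      (by ring)

/-- Interpolating between equal points changes nothing, so agreement reached in one patch survives
the following patches. -/
theorem interp_cutoff_of_eq (hb : MapsTo b p.L p.V) (hab : a x = b x) :
    p.interp a (p.cutoff b) x = b x := by
  by_cases h0 : p.ψ x = 0
  · rw [interp_of_eq_zero h0, hab]
  · have hx : x ∈ tsupport p.ψ := subset_tsupport _ h0
    have hbx := (hb (p.W_subset (p.tsupport_ψ hx))).1
    rw [interp_of_mem_source (by rwa [hab]), hab, cutoff, p.φ_one x hx, one_smul, ← add_smul,
      sub_add_cancel, one_smul, p.d.left_inv hbx]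

theorem interp_cutoff_of_eq_one (hb : MapsTo b p.L p.V) (h : p.ψ x = 1) :
    p.interp a (p.cutoff b) x = b x := by
  have hx : x ∈ tsupport p.ψ := subset_tsupport _ (by rw [Function.mem_support, h]; exact one_ne_zero)
  rw [interp_of_eq_one h, cutoff, p.φ_one x hx, one_smul,
    p.d.left_inv (hb (p.W_subset (p.tsupport_ψ hx))).1]

theorem mapsTo_cutoff (hb : MapsTo b p.L p.V) : MapsTo (p.cutoff b) (tsupport p.ψ) p.Ω := by
  intro x hx
  rw [cutoff, p.φ_one x hx, one_smul]
  exact (hb (p.W_subset (p.tsupport_ψ hx))).2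

theorem eventually_ψ_eq_zero (hx : x ∉ p.W) : ∀ᶠ y in 𝓝 x, p.ψ y = 0 := by
  filter_upwards [(isClosed_tsupport p.ψ).isOpen_compl.mem_nhds fun h => hx (p.tsupport_ψ h)]
    with y hy using image_eq_zero_of_notMem_tsupport hy

theorem eventually_φ_eq_zero (hx : x ∉ p.W) : ∀ᶠ y in 𝓝 x, p.φ y = 0 := by
  filter_upwards [(isClosed_tsupport p.φ).isOpen_compl.mem_nhds fun h => hx (p.tsupport_φ h)]
    with y hy using image_eq_zero_of_notMem_tsupport hy

section Continuity

variable {Z : Type*} [TopologicalSpace Z]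

theorem continuous_interp {A : Z × M → N} {Ξ : Z × M → Plane} (hA : Continuous A)
    (hΞ : Continuous Ξ) (hAp : ∀ z, MapsTo (fun x => A (z, x)) p.L p.V)
    (hΞp : ∀ z, MapsTo (fun x => Ξ (z, x)) (tsupport p.ψ) p.Ω) :
    Continuous fun q : Z × M => p.interp (fun x => A (q.1, x)) (fun x => Ξ (q.1, x)) q.2 := by
  rw [continuous_iff_continuousAt]
  rintro ⟨z, x⟩
  by_cases hx : x ∈ p.W
  · have hAx := (hAp z (p.W_subset hx)).1
    have hψ : ContinuousAt (fun q : Z × M => p.ψ q.2) (z, x) :=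
      (p.ψ_smooth.continuous.comp continuous_snd).continuousAt
    have hdA : ContinuousAt (fun q : Z × M => p.d (A q)) (z, x) :=
      ContinuousAt.comp (f := A) (g := p.d) (p.d.continuousAt hAx) hA.continuousAt
    have hv : ContinuousAt
        (fun q : Z × M => (1 - p.ψ q.2) • p.d (A q) + p.ψ q.2 • Ξ q) (z, x) :=
      ((continuousAt_const.sub hψ).smul hdA).add (hψ.smul hΞ.continuousAt)
    have hmem := p.Ω_subset (interpolant_mem (hAp z) (hΞp z) hx)
    refine (ContinuousAt.comp (f := fun q : Z × M =>
      (1 - p.ψ q.2) • p.d (A q) + p.ψ q.2 • Ξ q) (g := p.d.symm)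
      (p.d.continuousAt_symm hmem) hv).congr ?_
    filter_upwards [(p.isOpen_W.preimage continuous_snd).mem_nhds hx] with q hq
    exact (interp_of_mem_source (a := fun x => A (q.1, x)) (ξ := fun x => Ξ (q.1, x))
      (hAp q.1 (p.W_subset hq)).1).symm
  · refine hA.continuousAt.congr ?_
    filter_upwards [continuous_snd.continuousAt.eventually (eventually_ψ_eq_zero hx)] with q hq
    exact (interp_of_eq_zero (a := fun x => A (q.1, x)) hq).symm

theorem continuous_cutoff {A : Z × M → N} (hA : Continuous A)
    (hAp : ∀ z, MapsTo (fun x => A (z, x)) p.L p.V) :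
    Continuous fun q : Z × M => p.cutoff (fun x => A (q.1, x)) q.2 := by
  rw [continuous_iff_continuousAt]
  rintro ⟨z, x⟩
  by_cases hx : x ∈ p.W
  · have hdA : ContinuousAt (fun q : Z × M => p.d (A q)) (z, x) :=
      ContinuousAt.comp (f := A) (g := p.d) (p.d.continuousAt (hAp z (p.W_subset hx)).1)
        hA.continuousAt
    exact (p.φ_smooth.continuous.comp continuous_snd).continuousAt.smul hdA
  · refine (continuousAt_const (y := (0 : Plane))).congr ?_
    filter_upwards [continuous_snd.continuousAt.eventually (eventually_φ_eq_zero hx)] with q hq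
    simp [cutoff, hq]

/-- Joint continuity of the interpolation gives, by currying, continuity for the compact-open
topology. Off the open set of admissible pairs `T` has an arbitrary value, hence the local form of
the conclusion. -/
theorem exists_interpMap [LocallyCompactSpace M] [CompactSpace M] (g : C(M, N)) (ξ : C(M, Plane))
    (hg : MapsTo g p.L p.V) (hξ : MapsTo ξ (tsupport p.ψ) p.Ω) :
    ∃ T : C(M, N) × C(M, Plane) → C(M, N), ContinuousAt T (g, ξ) ∧
      ∀ᶠ q in 𝓝 (g, ξ), MapsTo q.1 p.L p.V ∧ MapsTo q.2 (tsupport p.ψ) p.Ω ∧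
        (T q : M → N) = p.interp q.1 q.2 := by
  classical
  let O : Set (C(M, N) × C(M, Plane)) := {q | MapsTo q.1 p.L p.V ∧ MapsTo q.2 (tsupport p.ψ) p.Ω}
  have hO : IsOpen O :=
    ((ContinuousMap.isOpen_setOfPred_mapsTo p.isCompact_L p.isOpen_V).preimage continuous_fst).inter
      ((ContinuousMap.isOpen_setOfPred_mapsTo (isClosed_tsupport p.ψ).isCompact
        p.isOpen_Ω).preimage continuous_snd)
  have hjoint : Continuous fun q : O × M => p.interp (fun x => q.1.1.1 x) (fun x => q.1.1.2 x) q.2 :=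
    continuous_interp (p := p) (A := fun q : O × M => q.1.1.1 q.2)
      (Ξ := fun q : O × M => q.1.1.2 q.2)
      ((continuous_fst.comp (continuous_subtype_val.comp continuous_fst)).eval continuous_snd)
      ((continuous_snd.comp (continuous_subtype_val.comp continuous_fst)).eval continuous_snd)
      (fun z => z.2.1) (fun z => z.2.2)
  let T₀ : O → C(M, N) := fun q =>
    ⟨p.interp q.1.1 q.1.2, hjoint.comp (Continuous.prodMk_right q)⟩
  have hT₀ : Continuous T₀ := ContinuousMap.continuous_of_continuous_uncurry _ hjoint
  let T : C(M, N) × C(M, Plane) → C(M, N) := fun q => if h : q ∈ O then T₀ ⟨q, h⟩ else q.1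
  have hT : ∀ q : O, T q = T₀ q := fun q => dif_pos q.2
  refine ⟨T, ?_, ?_⟩
  · have h1 : ContinuousOn T O := by
      rw [continuousOn_iff_continuous_domRestrict]
      exact hT₀.congr fun q => (hT q).symm
    exact h1.continuousAt (hO.mem_nhds ⟨hg, hξ⟩)
  · filter_upwards [hO.mem_nhds (show (g, ξ) ∈ O from ⟨hg, hξ⟩)] with q hq
    exact ⟨hq.1, hq.2, by rw [hT ⟨q, hq⟩]; rfl⟩

theorem exists_cutoffMap [LocallyCompactSpace M] (g : C(M, N)) (hg : MapsTo g p.L p.V) :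
    ∃ S : C(M, N) → C(M, Plane), ContinuousAt S g ∧ (S g : M → Plane) = p.cutoff g ∧
      ∀ᶠ b : C(M, N) in 𝓝 g, MapsTo b p.L p.V ∧ (S b : M → Plane) = p.cutoff b := by
  classical
  let O : Set C(M, N) := {b | MapsTo b p.L p.V}
  have hO : IsOpen O := ContinuousMap.isOpen_setOfPred_mapsTo p.isCompact_L p.isOpen_V
  have hjoint : Continuous fun q : O × M => p.cutoff (fun x => q.1.1 x) q.2 :=
    continuous_cutoff (p := p) (A := fun q : O × M => q.1.1 q.2)
      ((continuous_subtype_val.comp continuous_fst).eval continuous_snd) (fun z => z.2)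
  let S₀ : O → C(M, Plane) := fun b =>
    ⟨p.cutoff b.1, hjoint.comp (Continuous.prodMk_right b)⟩
  have hS₀ : Continuous S₀ := ContinuousMap.continuous_of_continuous_uncurry _ hjoint
  let S : C(M, N) → C(M, Plane) := fun b => if h : b ∈ O then S₀ ⟨b, h⟩ else 0
  have hS : ∀ b : O, S b = S₀ b := fun b => dif_pos b.2
  refine ⟨S, ?_, by rw [hS ⟨g, hg⟩]; rfl, ?_⟩
  · have h1 : ContinuousOn S O := by
      rw [continuousOn_iff_continuous_domRestrict]
      exact hS₀.congr fun b => (hS b).symm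
    exact h1.continuousAt (hO.mem_nhds hg)
  · filter_upwards [hO.mem_nhds hg] with b hb
    exact ⟨hb, by rw [hS ⟨b, hb⟩]; rfl⟩

end Continuity

section Smoothness

variable [IsManifold (𝓡 2) ∞ N]

/-- Where the weight is `1` nearby, `a` has been replaced by `ξ` entirely, so `a` itself need not be
smooth there. This is what lets patches smooth a continuous map. -/
theorem contMDiffAt_interp (ha : MapsTo a p.L p.V) 
    (hξ : MapsTo ξ (tsupport p.ψ) p.Ω) (hξs : ContMDiffAt (𝓡 2) (𝓡 2) ∞ ξ x)
    (h : ContMDiffAt (𝓡 2) (𝓡 2) ∞ a x ∨ ∀ᶠ y in 𝓝 x, p.ψ y = 1) :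
    ContMDiffAt (𝓡 2) (𝓡 2) ∞ (p.interp a ξ) x := by
  by_cases hx : x ∈ p.W
  · have hmem := interpolant_mem ha hξ hx
    have hv : ContMDiffAt (𝓡 2) (𝓡 2) ∞
        (fun y => (1 - p.ψ y) • p.d (a y) + p.ψ y • ξ y) x := by
      have hψ := p.ψ_smooth.contMDiffAt (x := x)
      rcases h with h | h
      · have hda : ContMDiffAt (𝓡 2) (𝓡 2) ∞ (fun y => p.d (a y)) x :=
          (contMDiffAt_chart p.hd (ha (p.W_subset hx)).1).comp x h
        exact ((contMDiffAt_const.sub hψ).smul hda).add (hψ.smul hξs)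
      · refine hξs.congr_of_eventuallyEq ?_
        filter_upwards [h] with y hy
        simp [hy]
    have := (contMDiffAt_chart_symm p.hd (p.Ω_subset hmem)).comp x hv
    refine this.congr_of_eventuallyEq ?_
    filter_upwards [p.isOpen_W.mem_nhds hx] with y hy
    exact interp_of_mem_source (ha (p.W_subset hy)).1
  · have h0 := eventually_ψ_eq_zero hx
    have h1 : ContMDiffAt (𝓡 2) (𝓡 2) ∞ a x := by
      refine h.resolve_right fun h1 => ?_
      obtain ⟨y, hy0, hy1⟩ := (h0.and h1).exists
      exact one_ne_zero (hy1.symm.trans hy0)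
    refine h1.congr_of_eventuallyEq ?_
    filter_upwards [h0] with y hy using interp_of_eq_zero hy

theorem contMDiff_cutoff (hb : MapsTo b p.L p.V) (hbs : ContMDiff (𝓡 2) (𝓡 2) ∞ b) :
    ContMDiff (𝓡 2) (𝓡 2) ∞ (p.cutoff b) := by
  intro x
  by_cases hx : x ∈ p.W
  · have hdb : ContMDiffAt (𝓡 2) (𝓡 2) ∞ (fun y => p.d (b y)) x :=
      (contMDiffAt_chart p.hd (hb (p.W_subset hx)).1).comp x hbs.contMDiffAt
    exact p.φ_smooth.contMDiffAt.smul hdb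
  · refine (contMDiffAt_const (c := (0 : Plane))).congr_of_eventuallyEq ?_
    filter_upwards [eventually_φ_eq_zero hx] with y hy
    simp [cutoff, hy]

/-- Interpolation in a patch does not change the twisted degree. -/
theorem hasTwistedDegree_interp [IsManifold (𝓡 2) ∞ M] [CompactSpace M] [T2Space M] [T2Space N] {k : ℝ}
    (ha : MapsTo a p.L p.V) (hξ : MapsTo ξ (tsupport p.ψ) p.Ω)
    (has : ContMDiff (𝓡 2) (𝓡 2) ∞ a) (hs : ContMDiff (𝓡 2) (𝓡 2) ∞ (p.interp a ξ))
    (h : HasTwistedDegree k a) : HasTwistedDegree k (p.interp a ξ) := by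
  refine h.of_eq_off_compact has hs p.hc p.hd p.isOpen_W p.isPreconnected_W
    (p.W_subset.trans p.L_subset) (isClosed_tsupport p.ψ).isCompact p.tsupport_ψ
    (fun x hx => (ha (p.W_subset hx)).1) (fun x hx => ?_) fun x hx => ?_
  · rw [interp_of_mem_source (ha (p.W_subset hx)).1]
    exact p.d.map_target (p.Ω_subset (interpolant_mem ha hξ hx))
  · exact (interp_of_eq_zero (image_eq_zero_of_notMem_tsupport hx)).symm

end Smoothness

theorem exists_of_continuousMap [IsManifold (𝓡 2) ∞ M] [T2Space M] (g : C(M, N)) (x : M) :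
    ∃ p : ChartPatch M N, MapsTo g p.L p.V ∧ ∀ᶠ y in 𝓝 x, p.ψ y = 1 := by
  set d := chartAt Plane (g x)
  have hgx : g x ∈ d.source := mem_chart_source Plane (g x)
  obtain ⟨r, hr, hrd⟩ := Metric.isOpen_iff.1 d.open_target _ (d.map_source hgx)
  have hV : g ⁻¹' (d.source ∩ d ⁻¹' Metric.ball (d (g x)) r) ∈ 𝓝 x :=
    g.continuous.continuousAt.preimage_mem_nhds
      ((d.isOpen_inter_preimage Metric.isOpen_ball).mem_nhds
        ⟨hgx, mem_preimage.2 (Metric.mem_ball_self hr)⟩)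
  -- Three nested bumps: `B` gives `W` and `L`, `φ` is supported in `W`, and `ψ` is supported where
  -- `φ` is `1`.
  obtain ⟨B, -, hB⟩ := (SmoothBumpFunction.nhds_basis_tsupport (I := 𝓡 2) x).mem_iff.1 hV
  obtain ⟨φ, -, hφ⟩ := (SmoothBumpFunction.nhds_basis_tsupport (I := 𝓡 2) x).mem_iff.1
    B.support_mem_nhds
  obtain ⟨ψ, -, hψ⟩ := (SmoothBumpFunction.nhds_basis_tsupport (I := 𝓡 2) x).mem_iff.1
    (inter_mem B.support_mem_nhds φ.eventuallyEq_one)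
  refine ⟨{ c := chartAt Plane x
            d := d
            W := Function.support B
            L := tsupport B
            Ω := Metric.ball (d (g x)) r
            ψ := ψ
            φ := φ
            hc := chart_mem_atlas Plane x
            hd := chart_mem_atlas Plane (g x)
            isOpen_W := B.isOpen_support
            isPreconnected_W := ?_
            isCompact_L := B.hasCompactSupport
            W_subset := subset_tsupport _
            L_subset := B.tsupport_subset_chartAt_source
            isOpen_Ω := Metric.isOpen_ball
            convex_Ω := convex_ball _ _
            Ω_subset := hrd
            ψ_smooth := ψ.contMDiff
            ψ_mem := fun _ => ψ.mem_Icc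
            tsupport_ψ := fun _ hy => (hψ hy).1
            φ_smooth := φ.contMDiff
            tsupport_φ := hφ
            φ_one := fun _ hy => (hψ hy).2 }, hB, ψ.eventuallyEq_one⟩
  rw [B.support_eq_symm_image]
  refine IsPreconnected.image ?_ _ ((continuousOn_extChartAt_symm x).mono B.ball_subset)
  simpa using (convex_ball _ _).isPreconnected

end ChartPatch

/-! ### Density of smooth maps and homotopy invariance of the twisted degree. -/

section HomotopyInvariance

variable {M N : Type*}
  [TopologicalSpace M] [ChartedSpace (EuclideanSpace ℝ (Fin 2)) M] [IsManifold (𝓡 2) ∞ M]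
  [CompactSpace M] [T2Space M]
  [TopologicalSpace N] [ChartedSpace (EuclideanSpace ℝ (Fin 2)) N]

theorem frequently_contMDiff_plane (ξ : C(M, Plane)) :
    ∃ᶠ ζ : C(M, Plane) in 𝓝 ξ, ContMDiff (𝓡 2) (𝓡 2) ∞ ζ := by
  rw [Metric.nhds_basis_ball.frequently_iff]
  intro ε hε
  obtain ⟨ζ, hζ, -⟩ := ξ.continuous.exists_contMDiff_approx (𝓡 2) ⊤ (ε := fun _ => ε)
    continuous_const (fun _ => hε)
  exact ⟨⟨ζ, ζ.contMDiff.continuous⟩, (ContinuousMap.dist_lt_iff hε).2 hζ, ζ.contMDiff⟩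

theorem exists_chartPatch_list (g : C(M, N)) :
    ∃ ℓ : List (ChartPatch M N), (∀ p ∈ ℓ, MapsTo g p.L p.V) ∧
      ∀ x, ∃ p ∈ ℓ, ∀ᶠ y in 𝓝 x, p.ψ y = 1 := by
  classical
  choose p hp hψ using ChartPatch.exists_of_continuousMap g
  obtain ⟨t, -, ht⟩ := isCompact_univ.elim_nhds_subcover
    (fun x => {z | ∀ᶠ y in 𝓝 z, (p x).ψ y = 1}) fun x _ => (hψ x).eventually_nhds
  refine ⟨t.toList.map p, fun q hq => ?_, fun x => ?_⟩
  · obtain ⟨x, -, rfl⟩ := List.mem_map.1 hq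
    exact hp x
  · obtain ⟨z, hz, hx⟩ := mem_iUnion₂.1 (ht (mem_univ x))
    exact ⟨p z, List.mem_map.2 ⟨z, Finset.mem_toList.2 hz, rfl⟩, hx⟩

variable [IsManifold (𝓡 2) ∞ N]

/-- Smooth maps are dense in the space of continuous maps. -/
theorem frequently_contMDiff (g : C(M, N)) :
    ∃ᶠ a : C(M, N) in 𝓝 g, ContMDiff (𝓡 2) (𝓡 2) ∞ a := by
  have : LocallyCompactSpace M := ChartedSpace.locallyCompactSpace Plane M
  have key (ℓ : List (ChartPatch M N)) (hℓ : ∀ p ∈ ℓ, MapsTo g p.L p.V) :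
      ∃ᶠ a : C(M, N) in 𝓝 g, ∀ p ∈ ℓ, ∀ x, (∀ᶠ y in 𝓝 x, p.ψ y = 1) →
        ContMDiffAt (𝓡 2) (𝓡 2) ∞ a x := by
    induction ℓ with
    | nil => simp
    | cons p ℓ ih =>
      have hg := hℓ p List.mem_cons_self
      obtain ⟨S, -, hSg, -⟩ := ChartPatch.exists_cutoffMap g hg
      obtain ⟨T, hT, hTev⟩ := ChartPatch.exists_interpMap g (S g) hg
        (hSg ▸ ChartPatch.mapsTo_cutoff hg)
      -- Interpolating `g` with its own cutoff returns `g`; by continuity, data near `(g, S g)`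
      -- yields maps near `g`.
      have hTg : T (g, S g) = g := by
        ext x
        rw [hTev.self_of_nhds.2.2, hSg]
        exact ChartPatch.interp_cutoff_of_eq hg rfl
      rw [ContinuousAt, hTg] at hT
      rw [frequently_iff]
      intro U hU
      obtain ⟨A, hA, X, hX, hAX⟩ := mem_nhds_prod_iff.1 (inter_mem (hT hU) hTev)
      obtain ⟨a, haA, has⟩ :=
        (frequently_iff.1 (ih fun q hq => hℓ q (List.mem_cons_of_mem p hq))) hA
      obtain ⟨ξ, hξX, hξs⟩ := frequently_iff.1 (frequently_contMDiff_plane (S g)) hX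
      obtain ⟨hU', ha, hξ, heq⟩ := hAX (mk_mem_prod haA hξX)
      refine ⟨T (a, ξ), hU', fun q hq x hx => ?_⟩
      rw [heq]
      refine ChartPatch.contMDiffAt_interp ha hξ hξs.contMDiffAt ?_
      rcases List.mem_cons.1 hq with rfl | hq
      · exact Or.inr hx
      · exact Or.inl (has q hq x hx)
  obtain ⟨ℓ, hℓ, hcov⟩ := exists_chartPatch_list g
  refine (key ℓ hℓ).mono fun a ha x => ?_
  obtain ⟨p, hp, hx⟩ := hcov x
  exact ha p hp x hx

/-- Nearby smooth maps have the same twisted degree. -/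
theorem eventually_hasTwistedDegree_imp [T2Space N] (k : ℝ) (g : C(M, N)) :
    ∀ᶠ q : C(M, N) × C(M, N) in 𝓝 g ×ˢ 𝓝 g, ContMDiff (𝓡 2) (𝓡 2) ∞ q.1 →
      ContMDiff (𝓡 2) (𝓡 2) ∞ q.2 → HasTwistedDegree k q.1 → HasTwistedDegree k q.2 := by
  have : LocallyCompactSpace M := ChartedSpace.locallyCompactSpace Plane M
  -- `R q` is obtained from `q.1` by moving it to `q.2` one patch at a time; it stays near `g`, so
  -- that every patch remains applicable.
  have key (ℓ : List (ChartPatch M N)) (hℓ : ∀ p ∈ ℓ, MapsTo g p.L p.V) :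
      ∃ R : C(M, N) × C(M, N) → C(M, N), Tendsto R (𝓝 g ×ˢ 𝓝 g) (𝓝 g) ∧
        ∀ᶠ q : C(M, N) × C(M, N) in 𝓝 g ×ˢ 𝓝 g,
          (ContMDiff (𝓡 2) (𝓡 2) ∞ q.1 → ContMDiff (𝓡 2) (𝓡 2) ∞ q.2 →
            ContMDiff (𝓡 2) (𝓡 2) ∞ (R q) ∧
            (HasTwistedDegree k q.1 → HasTwistedDegree k (R q))) ∧
          ∀ x, (∃ p ∈ ℓ, p.ψ x = 1) → R q x = q.2 x := by
    induction ℓ with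
    | nil => exact ⟨Prod.fst, tendsto_fst, by simp +contextual⟩
    | cons p ℓ ih =>
      obtain ⟨R, hR, hRev⟩ := ih fun q hq => hℓ q (List.mem_cons_of_mem p hq)
      have hg := hℓ p List.mem_cons_self
      obtain ⟨S, hS, hSg, hSev⟩ := ChartPatch.exists_cutoffMap g hg
      obtain ⟨T, hT, hTev⟩ := ChartPatch.exists_interpMap g (S g) hg
        (hSg ▸ ChartPatch.mapsTo_cutoff hg)
      have hTg : T (g, S g) = g := by
        ext x
        rw [hTev.self_of_nhds.2.2, hSg]
        exact ChartPatch.interp_cutoff_of_eq hg rfl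
      rw [ContinuousAt, hTg] at hT
      have hlim : Tendsto (fun q : C(M, N) × C(M, N) => (R q, S q.2)) (𝓝 g ×ˢ 𝓝 g)
          (𝓝 (g, S g)) := hR.prodMk_nhds (hS.tendsto.comp tendsto_snd)
      refine ⟨fun q => T (R q, S q.2), hT.comp hlim, ?_⟩
      filter_upwards [hRev, hlim.eventually hTev, tendsto_snd.eventually hSev]
        with q ⟨h1, h2⟩ ⟨ha, hξ, heq⟩ ⟨hb, hSb⟩
      rw [hSb] at hξ
      simp only [hSb] at heq
      refine ⟨fun hs1 hs2 => ?_, fun x hx => ?_⟩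
      · obtain ⟨hRs, hRk⟩ := h1 hs1 hs2
        have hs : ContMDiff (𝓡 2) (𝓡 2) ∞ (p.interp (R q) (p.cutoff q.2)) := fun x =>
          ChartPatch.contMDiffAt_interp ha hξ (ChartPatch.contMDiff_cutoff hb hs2).contMDiffAt
            (Or.inl hRs.contMDiffAt)
        rw [heq]
        exact ⟨hs, fun hk => ChartPatch.hasTwistedDegree_interp ha hξ hRs hs (hRk hk)⟩
      · rw [heq]
        obtain ⟨p', hp', hx⟩ := hx
        rcases List.mem_cons.1 hp' with rfl | hp'
        · exact ChartPatch.interp_cutoff_of_eq_one hb hx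
        · exact ChartPatch.interp_cutoff_of_eq hb (h2 x ⟨p', hp', hx⟩)
  obtain ⟨ℓ, hℓ, hcov⟩ := exists_chartPatch_list g
  obtain ⟨R, -, hRev⟩ := key ℓ hℓ
  filter_upwards [hRev] with q ⟨h1, h2⟩ hs1 hs2 hk
  have hRq : R q = q.2 := by
    ext x
    obtain ⟨p, hp, hx⟩ := hcov x
    exact h2 x ⟨p, hp, hx.self_of_nhds⟩
  exact hRq ▸ (h1 hs1 hs2).2 hk

/-- The twisted degree is a homotopy invariant of smooth maps. -/
theorem HasTwistedDegree.of_homotopic [T2Space N] {k : ℝ} {f h : C(M, N)}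
    (hf : ContMDiff (𝓡 2) (𝓡 2) ∞ f) (hh : ContMDiff (𝓡 2) (𝓡 2) ∞ h) (hhf : f.Homotopic h)
    (hk : HasTwistedDegree k f) : HasTwistedDegree k h := by
  -- Intermediate stages of a homotopy are only continuous, so membership is phrased through nearby
  -- smooth maps. Local invariance together with density of smooth maps makes the complement open
  -- too.
  let D : Set C(M, N) :=
    {g | ∀ᶠ a : C(M, N) in 𝓝 g, ContMDiff (𝓡 2) (𝓡 2) ∞ a → HasTwistedDegree k a}
  have hloc (g : C(M, N)) : ∃ U ∈ 𝓝 g, ∀ a ∈ U, ∀ b ∈ U, ContMDiff (𝓡 2) (𝓡 2) ∞ a →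
      ContMDiff (𝓡 2) (𝓡 2) ∞ b → HasTwistedDegree k a → HasTwistedDegree k b := by
    obtain ⟨U, hU, hUU⟩ := mem_prod_same_iff.1 (eventually_hasTwistedDegree_imp k g)
    exact ⟨U, hU, fun a ha b hb => hUU (mk_mem_prod ha hb)⟩
  have hopen : IsOpen D := isOpen_iff_mem_nhds.2 fun g hg => Eventually.eventually_nhds hg
  have hclosed : IsOpen Dᶜ := by
    rw [isOpen_iff_mem_nhds]
    intro g hg
    obtain ⟨U, hU, hUim⟩ := hloc g
    have hnone : ∀ b ∈ U, ContMDiff (𝓡 2) (𝓡 2) ∞ b → ¬ HasTwistedDegree k b := by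
      intro b hb hbs hbk
      exact hg (mem_of_superset hU fun a ha has => hUim b hb a ha hbs has hbk)
    filter_upwards [eventually_mem_nhds_iff.2 hU] with g' hg' hD
    obtain ⟨b, hbs, hbU, hbk⟩ := ((frequently_contMDiff g').and_eventually
      ((eventually_mem_set.2 hg').and hD)).exists
    exact hnone b hbU hbs (hbk hbs)
  obtain ⟨H⟩ := hhf
  have hclopen : IsClopen (H.curry ⁻¹' D) :=
    ⟨(isOpen_compl_iff.1 hclosed).preimage H.curry.continuous, hopen.preimage H.curry.continuous⟩
  have hfD : f ∈ D := by
    obtain ⟨U, hU, hUim⟩ := hloc f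
    exact mem_of_superset hU fun a ha has => hUim f (mem_of_mem_nhds hU) a ha hf has hk
  have huniv := hclopen.eq_univ ⟨0, by simpa using hfD⟩
  have hhD : h ∈ D := by
    have : (1 : unitInterval) ∈ H.curry ⁻¹' D := huniv ▸ mem_univ _
    simpa using this
  exact hhD.self_of_nhds hh

end HomotopyInvariance

/-! ### The geometric degree of a branched covering. -/

theorem mainTheorem7 {M N : Type*}
    [TopologicalSpace M] [T2Space M] [CompactSpace M] [ConnectedSpace M]
    [ChartedSpace (EuclideanSpace ℝ (Fin 2)) M] [IsManifold (𝓡 2) ∞ M]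
    [TopologicalSpace N] [T2Space N] [CompactSpace N] [ConnectedSpace N]
    [ChartedSpace (EuclideanSpace ℝ (Fin 2)) N] [IsManifold (𝓡 2) ∞ N]
    (k : ℕ) (f : C(M, N)) (hf : ContMDiff (𝓡 2) (𝓡 2) ∞ f) (hk : IsBranchedCovering k f) :
    geometricDegree f = k := by
  apply le_antisymm
  · obtain ⟨B, hB, -, -, hcard⟩ := hk
    have : SecondCountableTopology N := ChartedSpace.secondCountable_of_sigmaCompact Plane N
    have hres := (eventually_residual_isRegularValue hf).and hB.compl_mem_residual
    -- A regular value off `B`: its fibre under `f` itself realizes `k`.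
    obtain ⟨y, hy, hyB⟩ := (dense_of_mem_residual hres).nonempty
    exact sInf_le ⟨f, y, hf, .refl f, hy, hcard y hyB⟩
  · refine le_sInf ?_
    rintro _ ⟨h, y, hh, hhf, hy, rfl⟩
    exact ((hk.hasTwistedDegree hf).of_homotopic hf hh hhf.symm).le_encard hh hy
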